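/- Let $k$ be a field and let $(H,\sigma)$ be a coquasitriangular (CQT) Hopf algebra over $k$ (not assumed finite-dimensional), with antipode $S$: that is, $\sigma:H\otimes H\to k$ is a convolution-invertible bilinear form such that, in Sweedler notation $\Delta(h)=h_1\otimes h_2$, $$\sigma(hh',g)=\sigma(h,g_1)\sigma(h',g_2),\quad \sigma(g,hh')=\sigma(g_2,h)\sigma(g_1,h'),\quad \sigma(1,h)=\sigma(h,1)=\varepsilon(h),$$ $$\sigma(h_1,g_1)\,h_2g_2=g_1h_1\,\sigma(h_2,g_2)$$ for all $h,h',g\in H$. Let $\sigma^{-1}$ be the convolution inverse of $\sigma$ and put $\sigma^{-1}_{21}(a,b)=\sigma^{-1}(b,a)$. Let ${}_H\mathcal{YD}^H$ be the category of left-right Yetter–Drinfeld modules over $H$: left $H$-modules and right $H$-comodules $M$, with coaction $m\mapsto m_{(0)}\otimes m_{(1)}$, such that $h_1\bullet m_{(0)}\otimes h_2m_{(1)}=(h_2\bullet m)_{(0)}\otimes (h_2\bullet m)_{(1)}h_1$; morphisms are the linear maps preserving action and coaction. Its unit object is $k$ with the trivial action (via $\varepsilon$) and the trivial coaction $a\mapsto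 a\otimes 1$; the tensor product $M\otimes N$ has $h\bullet(m\otimes n)=h_1\bullet m\otimes h_2\bullet n$ and $m\otimes n\mapsto m_{(0)}\otimes n_{(0)}\otimes n_{(1)}m_{(1)}$; the braiding is $m\otimes n\mapsto n_{(0)}\otimes n_{(1)}\bullet m$. Then $S$ is bijective, and $H$ carries a braided Hopf algebra structure $\underline{H}$ within ${}_H\mathcal{YD}^H$ (an algebra and a coalgebra in this category, whose comultiplication and counit are multiplicative and unital with respect to the braided tensor product algebra, and which has an antipode, all structure maps being morphisms of the category). Namely, $\underline H$ is the vector space $H$, a left-right Yetter–Drinfeld module via $$x\mapsto x_{(0)}\otimes x_{(1)}=x_2\otimes S^{-1}(x_1)S^{-2}(x_3),$$ $$h\bullet x=\sigma(h,S^{-1}(x_1)S^{-2}(x_3))\,x_2=\sigma^{-1}_{21}(S^{-1}(x_3)x_1,h)\,x_2,$$ with the same unit and counit as $H$, and with multiplication, comultiplication and antipode $$x\cdot y=\sigma(S(x_1)x_3,S^{-1}(y_2))\,x_2y_1=\sigma^{-1}_{21}(y_2,S(x_1)x_3)\,x_2y_1,$$ $$\underline\Delta(x)=\sigma(S^{-1}(x_3)x_1,S^{-1}(x_6)x_4)\,x_2\otimes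 x_5=\sigma^{-1}_{21}(S(x_4)x_6,S^{-1}(x_3)x_1)\,x_2\otimes x_5,$$ $$\underline S(x)=\sigma(x_1S(x_3),S^{-1}(x_4))\,S(x_2)=\sigma^{-1}_{21}(x_4,x_1S(x_3))\,S(x_2)$$ for all $h,x,y\in H$. -/

import Mathlib

open scoped TensorProduct

noncomputable section

section IteratedCoproducts

variable (k : Type*) {H : Type*} [CommSemiring k] [AddCommMonoid H] [Module k H] [Coalgebra k H]

/-- `h ↦ h₁ ⊗ (h₂ ⊗ h₃)`. -/
def comulIter₃ : H →ₗ[k] H ⊗[k] (H ⊗[k] H) :=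
  (Coalgebra.comul (R := k) (A := H)).lTensor H ∘ₗ Coalgebra.comul

/-- `h ↦ h₁ ⊗ (h₂ ⊗ (h₃ ⊗ h₄))`. -/
def comulIter₄ : H →ₗ[k] H ⊗[k] (H ⊗[k] (H ⊗[k] H)) :=
  (comulIter₃ k (H := H)).lTensor H ∘ₗ Coalgebra.comul

/-- `h ↦ h₁ ⊗ (h₂ ⊗ (h₃ ⊗ (h₄ ⊗ h₅)))`. -/
def comulIter₅ : H →ₗ[k] H ⊗[k] (H ⊗[k] (H ⊗[k] (H ⊗[k] H))) :=
  (comulIter₄ k (H := H)).lTensor H ∘ₗ Coalgebra.comul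

/-- `h ↦ h₁ ⊗ (h₂ ⊗ (h₃ ⊗ (h₄ ⊗ (h₅ ⊗ h₆))))`. -/
def comulIter₆ : H →ₗ[k] H ⊗[k] (H ⊗[k] (H ⊗[k] (H ⊗[k] (H ⊗[k] H)))) :=
  (comulIter₅ k (H := H)).lTensor H ∘ₗ Coalgebra.comul

/-- The finite families represent the coproduct: `Δ(h) = ∑ᵢ h₁ᵢ ⊗ h₂ᵢ`. -/
def IsSweedler₂ (h : H) {n : ℕ} (h₁ h₂ : Fin n → H) : Prop :=
  Coalgebra.comul (R := k) h = ∑ i, h₁ i ⊗ₜ[k] h₂ i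

/-- The finite families represent the iterated coproduct `h₁ ⊗ h₂ ⊗ h₃`. -/
def IsSweedler₃ (h : H) {n : ℕ} (h₁ h₂ h₃ : Fin n → H) : Prop :=
  comulIter₃ k h = ∑ i, h₁ i ⊗ₜ[k] (h₂ i ⊗ₜ[k] h₃ i)

/-- The finite families represent the iterated coproduct `h₁ ⊗ h₂ ⊗ h₃ ⊗ h₄`. -/
def IsSweedler₄ (h : H) {n : ℕ} (h₁ h₂ h₃ h₄ : Fin n → H) : Prop :=
  comulIter₄ k h = ∑ i, h₁ i ⊗ₜ[k] (h₂ i ⊗ₜ[k] (h₃ i ⊗ₜ[k] h₄ i))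

/-- The finite families represent the iterated coproduct `h₁ ⊗ h₂ ⊗ h₃ ⊗ h₄ ⊗ h₅ ⊗ h₆`. -/
def IsSweedler₆ (h : H) {n : ℕ} (h₁ h₂ h₃ h₄ h₅ h₆ : Fin n → H) : Prop :=
  comulIter₆ k h =
    ∑ i, h₁ i ⊗ₜ[k] (h₂ i ⊗ₜ[k] (h₃ i ⊗ₜ[k] (h₄ i ⊗ₜ[k] (h₅ i ⊗ₜ[k] h₆ i))))

end IteratedCoproducts

/-- A coquasitriangular structure on a bialgebra `H`: a convolution invertible skew pairing
`form = σ : H ⊗ H → k`, with convolution inverse `inv = σ⁻¹`, satisfying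
`σ(h₁, g₁) h₂ g₂ = g₁ h₁ σ(h₂, g₂)`. The inverse is uniquely determined by `σ`. -/
structure CQTStructure (k H : Type*) [Field k] [Ring H] [Bialgebra k H] where
  form : H →ₗ[k] H →ₗ[k] k
  inv : H →ₗ[k] H →ₗ[k] k
  form_mul_inv : ∀ (h g : H) {n m : ℕ} (h₁ h₂ : Fin n → H) (g₁ g₂ : Fin m → H),
    IsSweedler₂ k h h₁ h₂ → IsSweedler₂ k g g₁ g₂ →
    ∑ i, ∑ j, form (h₁ i) (g₁ j) * inv (h₂ i) (g₂ j) =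
      Coalgebra.counit (R := k) h * Coalgebra.counit (R := k) g
  inv_mul_form : ∀ (h g : H) {n m : ℕ} (h₁ h₂ : Fin n → H) (g₁ g₂ : Fin m → H),
    IsSweedler₂ k h h₁ h₂ → IsSweedler₂ k g g₁ g₂ →
    ∑ i, ∑ j, inv (h₁ i) (g₁ j) * form (h₂ i) (g₂ j) =
      Coalgebra.counit (R := k) h * Coalgebra.counit (R := k) g
  mul_left : ∀ (h h' g : H) {n : ℕ} (g₁ g₂ : Fin n → H), IsSweedler₂ k g g₁ g₂ →
    form (h * h') g = ∑ i, form h (g₁ i) * form h' (g₂ i)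
  mul_right : ∀ (g h h' : H) {n : ℕ} (g₁ g₂ : Fin n → H), IsSweedler₂ k g g₁ g₂ →
    form g (h * h') = ∑ i, form (g₂ i) h * form (g₁ i) h'
  one_left : ∀ h : H, form 1 h = Coalgebra.counit (R := k) h
  one_right : ∀ h : H, form h 1 = Coalgebra.counit (R := k) h
  comm : ∀ (h g : H) {n m : ℕ} (h₁ h₂ : Fin n → H) (g₁ g₂ : Fin m → H),
    IsSweedler₂ k h h₁ h₂ → IsSweedler₂ k g g₁ g₂ →
    ∑ i, ∑ j, form (h₁ i) (g₁ j) • (h₂ i * g₂ j) =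
      ∑ i, ∑ j, form (h₂ i) (g₂ j) • (g₁ j * h₁ i)

/-- The bilinear form `σ⁻¹₂₁(a, b) = σ⁻¹(b, a)`. -/
def CQTStructure.inv₂₁ {k H : Type*} [Field k] [Ring H] [Bialgebra k H]
    (R : CQTStructure k H) : H →ₗ[k] H →ₗ[k] k := R.inv.flip

/-- The structure of a left-right Yetter–Drinfeld module over the bialgebra `H` on the vector
space `M`: a left action `h • m = act h m` and a right coaction `m ↦ m₍₀₎ ⊗ m₍₁₎`, subject to
`h₁ • m₍₀₎ ⊗ h₂ m₍₁₎ = (h₂ • m)₍₀₎ ⊗ (h₂ • m)₍₁₎ h₁`. -/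
structure LeftRightYD (k H M : Type*) [Field k] [Ring H] [Bialgebra k H]
    [AddCommGroup M] [Module k M] where
  act : H →ₗ[k] M →ₗ[k] M
  coact : M →ₗ[k] M ⊗[k] H
  act_one : act 1 = LinearMap.id
  act_mul : ∀ h g : H, act (h * g) = act h ∘ₗ act g
  coact_coassoc : (TensorProduct.assoc k M H H).toLinearMap ∘ₗ coact.rTensor H ∘ₗ coact =
    (Coalgebra.comul (R := k) (A := H)).lTensor M ∘ₗ coact
  coact_counit : (TensorProduct.rid k M).toLinearMap ∘ₗ
    (Coalgebra.counit (R := k) (A := H)).lTensor M ∘ₗ coact = LinearMap.id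
  compat : ∀ (h : H) {n : ℕ} (h₁ h₂ : Fin n → H), IsSweedler₂ k h h₁ h₂ → ∀ m : M,
    ∑ i, TensorProduct.map (act (h₁ i)) (LinearMap.mulLeft k (h₂ i)) (coact m) =
      ∑ i, (LinearMap.mulRight k (h₁ i)).lTensor M (coact (act (h₂ i) m))

namespace LeftRightYD

variable {k H M N : Type*} [Field k] [Ring H] [Bialgebra k H]
  [AddCommGroup M] [Module k M] [AddCommGroup N] [Module k N]

/-- Morphisms in the category of left-right Yetter–Drinfeld modules: linear maps that preserve
the action and the coaction. -/
structure IsHom (X : LeftRightYD k H M) (Y : LeftRightYD k H N) (f : M →ₗ[k] N) : Prop where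
  map_act : ∀ h : H, f ∘ₗ X.act h = Y.act h ∘ₗ f
  map_coact : f.rTensor H ∘ₗ X.coact = Y.coact ∘ₗ f

/-- `h • (m ⊗ n) = h₁ • m ⊗ h₂ • n`. -/
def tensorAct (X : LeftRightYD k H M) (Y : LeftRightYD k H N) :
    H →ₗ[k] (M ⊗[k] N) →ₗ[k] (M ⊗[k] N) :=
  TensorProduct.map₂ X.act Y.act ∘ₗ Coalgebra.comul

/-- `(m ⊗ h) ⊗ (n ⊗ g) ↦ (m ⊗ n) ⊗ g h`. -/
def mergeCoact (k H M N : Type*) [Field k] [Ring H] [Bialgebra k H]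
    [AddCommGroup M] [Module k M] [AddCommGroup N] [Module k N] :
    (M ⊗[k] H) ⊗[k] (N ⊗[k] H) →ₗ[k] (M ⊗[k] N) ⊗[k] H :=
  (LinearMap.mul' k H ∘ₗ (TensorProduct.comm k H H).toLinearMap).lTensor (M ⊗[k] N) ∘ₗ
    (TensorProduct.tensorTensorTensorComm k M H N H).toLinearMap

/-- `m ⊗ n ↦ (m₍₀₎ ⊗ n₍₀₎) ⊗ n₍₁₎ m₍₁₎`. -/
def tensorCoact (X : LeftRightYD k H M) (Y : LeftRightYD k H N) :
    M ⊗[k] N →ₗ[k] (M ⊗[k] N) ⊗[k] H :=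
  mergeCoact k H M N ∘ₗ TensorProduct.map X.coact Y.coact

@[simp] theorem mergeCoact_tmul (m : M) (h : H) (n : N) (g : H) :
    mergeCoact k H M N ((m ⊗ₜ h) ⊗ₜ (n ⊗ₜ g)) = (m ⊗ₜ n) ⊗ₜ (g * h) := by
  simp [mergeCoact]

@[simp] theorem tensorCoact_tmul (X : LeftRightYD k H M) (Y : LeftRightYD k H N) (m : M) (n : N) :
    tensorCoact X Y (m ⊗ₜ n) = mergeCoact k H M N (X.coact m ⊗ₜ Y.coact n) := rfl

theorem tensor_act_one (X : LeftRightYD k H M) (Y : LeftRightYD k H N) :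
    tensorAct X Y 1 = LinearMap.id := by
  simp [tensorAct, Algebra.TensorProduct.one_def, TensorProduct.map₂_apply_tmul, X.act_one,
    Y.act_one]

theorem tensor_act_mul (X : LeftRightYD k H M) (Y : LeftRightYD k H N) (h g : H) :
    tensorAct X Y (h * g) = tensorAct X Y h ∘ₗ tensorAct X Y g := by
  have key : ∀ s t : H ⊗[k] H, TensorProduct.map₂ X.act Y.act (s * t) =
      TensorProduct.map₂ X.act Y.act s ∘ₗ TensorProduct.map₂ X.act Y.act t := by
    intro s t
    induction s with
    | zero => simp
    | add a b ha hb => simp only [add_mul, map_add, ha, hb, LinearMap.add_comp]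
    | tmul a b =>
      induction t with
      | zero => simp
      | add c d hc hd => simp only [mul_add, map_add, hc, hd, LinearMap.comp_add]
      | tmul c d =>
        simp only [Algebra.TensorProduct.tmul_mul_tmul, TensorProduct.map₂_apply_tmul, X.act_mul,
          Y.act_mul, TensorProduct.map_comp]
  simp only [tensorAct, LinearMap.comp_apply, Bialgebra.comul_mul, key]

theorem tensor_coassoc (X : LeftRightYD k H M) (Y : LeftRightYD k H N) :
    (TensorProduct.assoc k (M ⊗[k] N) H H).toLinearMap ∘ₗ (tensorCoact X Y).rTensor H ∘ₗ
        tensorCoact X Y =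
      (Coalgebra.comul (R := k) (A := H)).lTensor (M ⊗[k] N) ∘ₗ tensorCoact X Y := by
  let Φ : (M ⊗[k] (H ⊗[k] H)) ⊗[k] (N ⊗[k] (H ⊗[k] H)) →ₗ[k] (M ⊗[k] N) ⊗[k] (H ⊗[k] H) :=
    (LinearMap.mul' k (H ⊗[k] H) ∘ₗ (TensorProduct.comm k _ _).toLinearMap).lTensor (M ⊗[k] N) ∘ₗ
      (TensorProduct.tensorTensorTensorComm k M (H ⊗[k] H) N (H ⊗[k] H)).toLinearMap
  have hΦ : ∀ (m : M) (s : H ⊗[k] H) (n : N) (t : H ⊗[k] H),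
      Φ ((m ⊗ₜ s) ⊗ₜ (n ⊗ₜ t)) = (m ⊗ₜ n) ⊗ₜ (t * s) := by
    intro m s n t; simp [Φ]
  have hA : ∀ (a : M ⊗[k] H) (b : N ⊗[k] H),
      TensorProduct.assoc k (M ⊗[k] N) H H
        ((tensorCoact X Y).rTensor H (mergeCoact k H M N (a ⊗ₜ b))) =
      Φ (TensorProduct.assoc k M H H (X.coact.rTensor H a) ⊗ₜ
        TensorProduct.assoc k N H H (Y.coact.rTensor H b)) := by
    intro a b
    induction a with
    | zero => simp
    | add a a' ha ha' => simp only [TensorProduct.add_tmul, map_add, ha, ha']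
    | tmul m h =>
      induction b with
      | zero => simp
      | add b b' hb hb' => simp only [TensorProduct.tmul_add, map_add, hb, hb']
      | tmul n g =>
        simp only [mergeCoact_tmul, LinearMap.rTensor_tmul, tensorCoact_tmul]
        generalize X.coact m = x
        generalize Y.coact n = y
        induction x with
        | zero => simp
        | add x x' hx hx' => simp only [TensorProduct.add_tmul, map_add, hx, hx']
        | tmul m' h' =>
          induction y with
          | zero => simp
          | add y y' hy hy' => simp only [TensorProduct.tmul_add, TensorProduct.add_tmul, map_add,
              hy, hy']
          | tmul n' g' => simp [hΦ]
  have hB : ∀ (a : M ⊗[k] H) (b : N ⊗[k] H),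
      (Coalgebra.comul (R := k) (A := H)).lTensor (M ⊗[k] N) (mergeCoact k H M N (a ⊗ₜ b)) =
      Φ ((Coalgebra.comul (R := k) (A := H)).lTensor M a ⊗ₜ
        (Coalgebra.comul (R := k) (A := H)).lTensor N b) := by
    intro a b
    induction a with
    | zero => simp
    | add a a' ha ha' => simp only [TensorProduct.add_tmul, map_add, ha, ha']
    | tmul m h =>
      induction b with
      | zero => simp
      | add b b' hb hb' => simp only [TensorProduct.tmul_add, map_add, hb, hb']
      | tmul n g => simp [hΦ]
  ext m n
  have h1 := LinearMap.congr_fun X.coact_coassoc m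
  have h2 := LinearMap.congr_fun Y.coact_coassoc n
  simp only [LinearMap.comp_apply, LinearEquiv.coe_coe] at h1 h2
  simp only [TensorProduct.AlgebraTensorModule.curry_apply, TensorProduct.curry_apply,
    LinearMap.coe_restrictScalars, LinearMap.comp_apply, LinearEquiv.coe_coe, tensorCoact_tmul]
  rw [hA, hB, h1, h2]

theorem tensor_counit (X : LeftRightYD k H M) (Y : LeftRightYD k H N) :
    (TensorProduct.rid k (M ⊗[k] N)).toLinearMap ∘ₗ
      (Coalgebra.counit (R := k) (A := H)).lTensor (M ⊗[k] N) ∘ₗ tensorCoact X Y =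
        LinearMap.id := by
  have hA : ∀ (a : M ⊗[k] H) (b : N ⊗[k] H),
      TensorProduct.rid k (M ⊗[k] N)
        ((Coalgebra.counit (R := k) (A := H)).lTensor (M ⊗[k] N)
          (mergeCoact k H M N (a ⊗ₜ b))) =
      TensorProduct.rid k M ((Coalgebra.counit (R := k) (A := H)).lTensor M a) ⊗ₜ
        TensorProduct.rid k N ((Coalgebra.counit (R := k) (A := H)).lTensor N b) := by
    intro a b
    induction a with
    | zero => simp
    | add a a' ha ha' => simp only [TensorProduct.add_tmul, map_add, ha, ha']
    | tmul m h =>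
      induction b with
      | zero => simp
      | add b b' hb hb' => simp only [TensorProduct.tmul_add, map_add, hb, hb']
      | tmul n g => simp [TensorProduct.smul_tmul', smul_smul]
  ext m n
  have h1 := LinearMap.congr_fun X.coact_counit m
  have h2 := LinearMap.congr_fun Y.coact_counit n
  simp only [LinearMap.comp_apply, LinearEquiv.coe_coe] at h1 h2
  simp only [TensorProduct.AlgebraTensorModule.curry_apply, TensorProduct.curry_apply,
    LinearMap.coe_restrictScalars, LinearMap.comp_apply, LinearEquiv.coe_coe, tensorCoact_tmul]
  rw [hA, h1, h2]
  rfl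

/-- `h ⊗ g ↦ h • m₍₀₎ ⊗ g m₍₁₎`, so that `h₁ ⊗ h₂` goes to the left side of `compat`. -/
def compatLeft (X : LeftRightYD k H M) (m : M) : H ⊗[k] H →ₗ[k] M ⊗[k] H :=
  (TensorProduct.map₂ X.act (LinearMap.mul k H)).flip (X.coact m)

/-- `h ⊗ g ↦ (g • m)₍₀₎ ⊗ (g • m)₍₁₎ h`, so that `h₁ ⊗ h₂` goes to the right side of `compat`. -/
def compatRight (X : LeftRightYD k H M) (m : M) : H ⊗[k] H →ₗ[k] M ⊗[k] H :=
  TensorProduct.lift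
    ((LinearMap.lTensorHom M ∘ₗ (LinearMap.mul k H).flip).compl₂ (X.coact ∘ₗ X.act.flip m))

theorem compat_comul (X : LeftRightYD k H M) (m : M) :
    compatLeft X m ∘ₗ Coalgebra.comul = compatRight X m ∘ₗ Coalgebra.comul := by
  ext a
  obtain ⟨r, u, v, huv⟩ := TensorProduct.exists_sum_tmul_eq (Coalgebra.comul (R := k) a)
  have := X.compat a u v huv m
  simp only [LinearMap.comp_apply]
  rw [huv]
  simp only [compatLeft, compatRight, map_sum, LinearMap.flip_apply,
    TensorProduct.map₂_apply_tmul, TensorProduct.lift.tmul]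
  exact this

theorem tensor_compat (X : LeftRightYD k H M) (Y : LeftRightYD k H N) (h : H) {l : ℕ}
    (h₁ h₂ : Fin l → H) (hh : IsSweedler₂ k h h₁ h₂) (z : M ⊗[k] N) :
    ∑ i, TensorProduct.map (tensorAct X Y (h₁ i)) (LinearMap.mulLeft k (h₂ i))
        (tensorCoact X Y z) =
      ∑ i, (LinearMap.mulRight k (h₁ i)).lTensor (M ⊗[k] N)
        (tensorCoact X Y (tensorAct X Y (h₂ i) z)) := by
  induction z with
  | zero => simp
  | add z z' hz hz' => simp only [map_add, Finset.sum_add_distrib, hz, hz']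
  | tmul m n =>
  let T := TensorProduct.curry (mergeCoact k H M N)
  let f : H →ₗ[k] M ⊗[k] H := (LinearMap.rTensorHom H ∘ₗ X.act).flip (X.coact m)
  let g : H →ₗ[k] N ⊗[k] H := Y.coact ∘ₗ Y.act.flip n
  let F := TensorProduct.lift (T.compl₁₂ f (compatLeft Y n))
  let Gr := TensorProduct.lift (T.compl₁₂ f (compatRight Y n))
  let Gl := TensorProduct.lift (T.compl₁₂ (compatLeft X m) g)
  let Kl := TensorProduct.lift (T.compl₁₂ (compatRight X m) g)
  have hG : ∀ t, Gr (TensorProduct.assoc k H H H t) = Gl t := by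
    intro t
    have : Gr ∘ₗ (TensorProduct.assoc k H H H).toLinearMap = Gl := by
      ext a b c
      simp only [TensorProduct.AlgebraTensorModule.curry_apply, TensorProduct.curry_apply,
        LinearMap.coe_restrictScalars, LinearMap.comp_apply, LinearEquiv.coe_coe,
        TensorProduct.assoc_tmul, Gr, Gl, TensorProduct.lift.tmul, LinearMap.compl₁₂_apply, f, g,
        compatLeft, compatRight, T, LinearMap.compl₂_apply, LinearMap.flip_apply,
        TensorProduct.map₂_apply_tmul, LinearMap.coe_lTensorHom, LinearMap.coe_rTensorHom]
      generalize X.coact m = x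
      generalize Y.coact (Y.act c n) = y
      induction x with
      | zero => simp
      | add x x' hx hx' => simp only [TensorProduct.add_tmul, map_add, hx, hx']
      | tmul m' h' =>
        induction y with
        | zero => simp
        | add y y' hy hy' => simp only [TensorProduct.tmul_add, map_add, hy, hy']
        | tmul n' g' => simp [mul_assoc]
    exact LinearMap.congr_fun this t
  have hF : ∀ (t : H ⊗[k] H) (b : H),
      TensorProduct.map (TensorProduct.map₂ X.act Y.act t) (LinearMap.mulLeft k b)
        (tensorCoact X Y (m ⊗ₜ n)) = F (TensorProduct.assoc k H H H (t ⊗ₜ b)) := by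
    intro t b
    induction t with
    | zero => simp
    | add t t' ht ht' => simp only [TensorProduct.add_tmul, map_add, TensorProduct.map_add_left,
        LinearMap.add_apply, ht, ht']
    | tmul a c =>
      simp only [TensorProduct.assoc_tmul, F, TensorProduct.lift.tmul, LinearMap.compl₁₂_apply, f,
        compatLeft, T, LinearMap.comp_apply, LinearMap.flip_apply, TensorProduct.curry_apply,
        TensorProduct.map₂_apply_tmul, LinearMap.coe_rTensorHom, tensorCoact_tmul]
      generalize X.coact m = x
      generalize Y.coact n = y
      induction x with
      | zero => simp
      | add x x' hx hx' => simp only [TensorProduct.add_tmul, map_add, hx, hx']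
      | tmul m' h' =>
        induction y with
        | zero => simp
        | add y y' hy hy' => simp only [TensorProduct.tmul_add, map_add, hy, hy']
        | tmul n' g' => simp [mul_assoc]
  have hK : ∀ (a : H) (t : H ⊗[k] H),
      (LinearMap.mulRight k a).lTensor (M ⊗[k] N)
        (tensorCoact X Y (TensorProduct.map₂ X.act Y.act t (m ⊗ₜ n))) =
      Kl ((TensorProduct.assoc k H H H).symm (a ⊗ₜ t)) := by
    intro a t
    induction t with
    | zero => simp
    | add t t' ht ht' => simp only [TensorProduct.tmul_add, map_add, LinearMap.add_apply, ht, ht']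
    | tmul b c =>
      simp only [TensorProduct.assoc_symm_tmul, Kl, TensorProduct.lift.tmul,
        LinearMap.compl₁₂_apply, g, compatRight, T, LinearMap.comp_apply, LinearMap.flip_apply,
        TensorProduct.curry_apply, TensorProduct.map₂_apply_tmul, LinearMap.compl₂_apply,
        LinearMap.coe_lTensorHom, TensorProduct.map_tmul, tensorCoact_tmul]
      generalize X.coact (X.act b m) = x
      generalize Y.coact (Y.act c n) = y
      induction x with
      | zero => simp
      | add x x' hx hx' => simp only [TensorProduct.add_tmul, map_add, hx, hx']
      | tmul m' h' =>
        induction y with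
        | zero => simp
        | add y y' hy hy' => simp only [TensorProduct.tmul_add, map_add, hy, hy']
        | tmul n' g' => simp [mul_assoc]
  have hFG : F ∘ₗ (Coalgebra.comul (R := k) (A := H)).lTensor H =
      Gr ∘ₗ (Coalgebra.comul (R := k) (A := H)).lTensor H := by
    ext a b
    have := LinearMap.congr_fun (compat_comul Y n) b
    simp only [LinearMap.comp_apply] at this
    simp [F, Gr, this]
  have hGK : Gl ∘ₗ (Coalgebra.comul (R := k) (A := H)).rTensor H =
      Kl ∘ₗ (Coalgebra.comul (R := k) (A := H)).rTensor H := by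
    ext a b
    have := LinearMap.congr_fun (compat_comul X m) a
    simp only [LinearMap.comp_apply] at this
    simp [Gl, Kl, this]
  have h1 : ∑ i, TensorProduct.map (tensorAct X Y (h₁ i)) (LinearMap.mulLeft k (h₂ i))
        (tensorCoact X Y (m ⊗ₜ n)) =
      F (TensorProduct.assoc k H H H
        ((Coalgebra.comul (R := k) (A := H)).rTensor H (Coalgebra.comul h))) := by
    rw [hh, map_sum, map_sum, map_sum]
    exact Finset.sum_congr rfl fun i _ => hF _ _
  have h2 : ∑ i, (LinearMap.mulRight k (h₁ i)).lTensor (M ⊗[k] N)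
        (tensorCoact X Y (tensorAct X Y (h₂ i) (m ⊗ₜ n))) =
      Kl ((TensorProduct.assoc k H H H).symm
        ((Coalgebra.comul (R := k) (A := H)).lTensor H (Coalgebra.comul h))) := by
    rw [hh, map_sum, map_sum, map_sum]
    exact Finset.sum_congr rfl fun i _ => hK _ _
  rw [h1, h2, Coalgebra.coassoc_symm_apply, Coalgebra.coassoc_apply]
  have h3 := LinearMap.congr_fun hFG (Coalgebra.comul h)
  have h4 := LinearMap.congr_fun hGK (Coalgebra.comul h)
  simp only [LinearMap.comp_apply] at h3 h4
  rw [h3, ← h4, ← hG, Coalgebra.coassoc_apply]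

/-- The tensor product of two left-right Yetter–Drinfeld modules. -/
def tensor (X : LeftRightYD k H M) (Y : LeftRightYD k H N) : LeftRightYD k H (M ⊗[k] N) where
  act := tensorAct X Y
  coact := tensorCoact X Y
  act_one := tensor_act_one X Y
  act_mul := tensor_act_mul X Y
  coact_coassoc := tensor_coassoc X Y
  coact_counit := tensor_counit X Y
  compat := fun h _ h₁ h₂ hh z => tensor_compat X Y h h₁ h₂ hh z

/-- The unit object: the ground field with `h • a = ε(h) a` and coaction `a ↦ a ⊗ 1`. -/
def unitObj (k H : Type*) [Field k] [Ring H] [Bialgebra k H] : LeftRightYD k H k where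
  act := (LinearMap.lsmul k k).comp (Coalgebra.counit (R := k) (A := H))
  coact := (TensorProduct.mk k k H).flip 1
  act_one := by ext; simp
  act_mul := by intro h g; ext; simp
  coact_coassoc := by ext; simp [Algebra.TensorProduct.one_def]
  coact_counit := by ext; simp
  compat := by
    intro h n h₁ h₂ hh m
    have e1 : ∑ i, Coalgebra.counit (R := k) (h₁ i) • h₂ i = h := by
      have := Coalgebra.rTensor_counit_comul (R := k) h
      rw [hh] at this
      simpa using congrArg (TensorProduct.lid k H) this
    have e2 : ∑ i, Coalgebra.counit (R := k) (h₂ i) • h₁ i = h := by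
      have := Coalgebra.lTensor_counit_comul (R := k) h
      rw [hh] at this
      simpa using congrArg (TensorProduct.rid k H) this
    have e3 : ∀ (f : Fin n → H) (c : Fin n → k),
        ∑ i, (c i * m) ⊗ₜ[k] f i = m ⊗ₜ[k] (∑ i, c i • f i) := by
      intro f c
      rw [TensorProduct.tmul_sum]
      refine Finset.sum_congr rfl fun i _ => ?_
      rw [← smul_eq_mul, TensorProduct.smul_tmul]
    simp [e3, e1, e2]

/-- The braiding `m ⊗ n ↦ n₍₀₎ ⊗ n₍₁₎ • m` of the category of left-right Yetter–Drinfeld modules. -/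
def braiding (X : LeftRightYD k H M) (Y : LeftRightYD k H N) : M ⊗[k] N →ₗ[k] N ⊗[k] M :=
  (TensorProduct.lift X.act).lTensor N ∘ₗ (TensorProduct.assoc k N H M).toLinearMap ∘ₗ
    Y.coact.rTensor M ∘ₗ (TensorProduct.comm k M N).toLinearMap

/-- `(m ⊗ m') ⊗ (n ⊗ n') ↦ (m ⊗ c(m' ⊗ n)) ⊗ n'`, reassociated: the middle braiding
`id ⊗ c ⊗ id` on `M ⊗ M ⊗ M ⊗ M`. -/
def middleBraiding (X : LeftRightYD k H M) :
    (M ⊗[k] M) ⊗[k] (M ⊗[k] M) →ₗ[k] (M ⊗[k] M) ⊗[k] (M ⊗[k] M) :=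
  (TensorProduct.assoc k M M (M ⊗[k] M)).symm.toLinearMap ∘ₗ
    ((TensorProduct.assoc k M M M).toLinearMap ∘ₗ (braiding X X).rTensor M ∘ₗ
      (TensorProduct.assoc k M M M).symm.toLinearMap).lTensor M ∘ₗ
        (TensorProduct.assoc k M M (M ⊗[k] M)).toLinearMap

end LeftRightYD

/-- A Hopf algebra in the braided monoidal category of left-right Yetter–Drinfeld modules over
`H`, with underlying object `X`: an algebra and a coalgebra there, all of whose structure maps
are morphisms of the category, such that the comultiplication and counit are algebra maps (for
the braided tensor product algebra on `X ⊗ X`), with a convolution inverse of the identity. -/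
structure BraidedHopfAlgebra {k H M : Type*} [Field k] [Ring H] [Bialgebra k H]
    [AddCommGroup M] [Module k M] (X : LeftRightYD k H M) where
  mul : M ⊗[k] M →ₗ[k] M
  unit : k →ₗ[k] M
  comul : M →ₗ[k] M ⊗[k] M
  counit : M →ₗ[k] k
  antipode : M →ₗ[k] M
  mul_isHom : (X.tensor X).IsHom X mul
  unit_isHom : (LeftRightYD.unitObj k H).IsHom X unit
  comul_isHom : X.IsHom (X.tensor X) comul
  counit_isHom : X.IsHom (LeftRightYD.unitObj k H) counit
  antipode_isHom : X.IsHom X antipode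
  mul_assoc : mul ∘ₗ mul.rTensor M =
    mul ∘ₗ mul.lTensor M ∘ₗ (TensorProduct.assoc k M M M).toLinearMap
  unit_mul : mul ∘ₗ unit.rTensor M = (TensorProduct.lid k M).toLinearMap
  mul_unit : mul ∘ₗ unit.lTensor M = (TensorProduct.rid k M).toLinearMap
  comul_coassoc : (TensorProduct.assoc k M M M).toLinearMap ∘ₗ comul.rTensor M ∘ₗ comul =
    comul.lTensor M ∘ₗ comul
  counit_comul : (TensorProduct.lid k M).toLinearMap ∘ₗ counit.rTensor M ∘ₗ comul = LinearMap.id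
  comul_counit : (TensorProduct.rid k M).toLinearMap ∘ₗ counit.lTensor M ∘ₗ comul = LinearMap.id
  comul_mul : comul ∘ₗ mul =
    TensorProduct.map mul mul ∘ₗ X.middleBraiding ∘ₗ TensorProduct.map comul comul
  comul_unit : comul (unit 1) = unit 1 ⊗ₜ[k] unit 1
  counit_mul : counit ∘ₗ mul = LinearMap.mul' k k ∘ₗ TensorProduct.map counit counit
  counit_unit : counit (unit 1) = 1
  antipode_left : mul ∘ₗ antipode.rTensor M ∘ₗ comul = unit ∘ₗ counit
  antipode_right : mul ∘ₗ antipode.lTensor M ∘ₗ comul = unit ∘ₗ counit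

end

open scoped TensorProduct

noncomputable section

-- Write τ for σ⁻¹, and x₍₀₎ ⊗ x₍₁₎ for the coadjoint coaction x₂ ⊗ S(x₁)x₃. The argument is Majid's
-- transmutation: the operations of H are twisted by σ until they become colinear for the coadjoint
-- coaction.
--
-- Bijectivity of S: the functional u(x) = τ(S(x₁), x₂) is convolution invertible and satisfies
-- S²(x₁)u(x₂) = u(x₁)x₂. Hence S², composed with one bijection, equals another, so S is bijective
-- (`antipode_bijective`).
--
-- Yetter–Drinfeld side: any right comodule becomes a Yetter–Drinfeld module under h • m = σ(h,
-- m₍₁₎)m₍₀₎; the compatibility condition is the commutation axiom of σ. Such induced modules are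
-- closed under tensor products, and a colinear map between them is automatically linear over the
-- action, so only colinearity has to be checked. The coaction in the theorem is the coadjoint one
-- followed by S⁻². Since σ is invariant under S⁻¹ ⊗ S⁻¹, the braiding is x ⊗ y ↦ y₍₀₎ ⊗ θ(y₍₁₎, x)
-- with θ(h, x) = σ(h, x₍₁₎)x₍₀₎, and the algebra can be done with the coadjoint coaction alone.
--
-- Product: x·y = x₍₀₎ α(x₍₁₎, y), where α(h, y) = τ(h, y₂)y₁ is a right action for which H is a
-- module algebra. Associativity follows from this and from colinearity of the product
-- (`sw_coadjoint_bmul`).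
--
-- Coproduct: Δ twisted by σ evaluated on the two coadjoint legs. It is coassociative because σ is a
-- 2-cocycle (`form_yang_baxter`), and colinear because σ exchanges the two orders of
-- multiplication.
--
-- Multiplicativity of the coproduct (`bcomul_bmul`) is the deepest identity. It reduces to an
-- exchange rule between θ and α (`sw_coadjointAct_bmul_regAct`), which rests on the map y ↦ θ(y₁,
-- y₂).
--
-- Antipode: it is colinear, and the product after a θ-twist is almost the product of H,
-- x₍₀₎·θ(x₍₁₎, q) = σ(x₍₁₎, S(q₁)) x₍₀₎q₂. Both antipode axioms then collapse by cancelling σ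
-- against τ and applying the antipode axioms of H; the right-hand one also uses u to remove an S².

attribute [fun_prop] IsLinearMap

/-! ### Linearity of unbundled maps, as a `fun_prop` calculus -/

namespace IsLinearMap

variable {k U V W A B : Type*} [CommSemiring k] [AddCommMonoid U] [Module k U] [AddCommMonoid V]
  [Module k V] [AddCommMonoid W] [Module k W] [Semiring A] [Algebra k A]

@[fun_prop]
theorem fun_id : IsLinearMap k fun x : V => x := ⟨fun _ _ => rfl, fun _ _ => rfl⟩

@[fun_prop]
theorem fun_comp {f : V → W} {g : U → V} (hf : IsLinearMap k f) (hg : IsLinearMap k g) :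
    IsLinearMap k fun x => f (g x) :=
  ⟨fun x y => by rw [hg.map_add, hf.map_add], fun c x => by rw [hg.map_smul, hf.map_smul]⟩

@[fun_prop]
theorem apply (f : V →ₗ[k] W) : IsLinearMap k fun x => f x := f.isLinear

@[fun_prop]
theorem apply_apply (f : U →ₗ[k] V →ₗ[k] W) (y : V) : IsLinearMap k fun x => f x y :=
  (f.flip y).isLinear

@[fun_prop]
theorem mul_const (a : A) : IsLinearMap k fun x : A => x * a :=
  (LinearMap.mulRight k a).isLinear

@[fun_prop]
theorem const_mul (a : A) : IsLinearMap k fun x : A => a * x :=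
  (LinearMap.mulLeft k a).isLinear

@[fun_prop]
theorem tmul_const (w : W) : IsLinearMap k fun x : V => x ⊗ₜ[k] w :=
  ((TensorProduct.mk k V W).flip w).isLinear

@[fun_prop]
theorem const_tmul (v : V) : IsLinearMap k fun x : W => v ⊗ₜ[k] x :=
  (TensorProduct.mk k V W v).isLinear

@[fun_prop]
theorem smul_const (v : V) : IsLinearMap k fun c : k => c • v :=
  (LinearMap.toSpanSingleton k V v).isLinear

@[fun_prop]
theorem const_smul (c : k) : IsLinearMap k fun v : V => c • v :=
  (LinearMap.lsmul k V c).isLinear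

@[fun_prop]
theorem fun_sum {ι : Type*} (s : Finset ι) {f : ι → V → W} (h : ∀ i, IsLinearMap k (f i)) :
    IsLinearMap k fun x => ∑ i ∈ s, f i x :=
  ⟨fun x y => by simp only [(h _).map_add, Finset.sum_add_distrib],
    fun c x => by simp only [(h _).map_smul, Finset.smul_sum]⟩

end IsLinearMap

/-! ### Sweedler sums over a tensor -/

section Sweedler

variable {k U V W Z Y : Type*} [CommSemiring k] [AddCommMonoid U] [Module k U] [AddCommMonoid V]
  [Module k V] [AddCommMonoid W] [Module k W] [AddCommMonoid Z] [Module k Z] [AddCommMonoid Y]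
  [Module k Y]

/-- Sweedler notation for tensors: `sw t f` is `∑ f(t₁, t₂)` for a chosen expression
`t = ∑ t₁ ⊗ t₂`, which does not depend on the choice if `f` is bilinear. -/
def sw (t : V ⊗[k] W) (f : V → W → Z) : Z :=
  ∑ p ∈ (TensorProduct.exists_finset t).choose, f p.1 p.2

/-- The bundled form of an unbundled bilinear map. -/
def mkBilin (f : V → W → Z) (h₁ : ∀ w, IsLinearMap k fun v => f v w)
    (h₂ : ∀ v, IsLinearMap k fun w => f v w) : V →ₗ[k] W →ₗ[k] Z :=
  LinearMap.mk₂ k f (fun a b c => (h₁ c).map_add a b) (fun c a b => (h₁ b).map_smul c a)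
    (fun a b c => (h₂ a).map_add b c) (fun c a b => (h₂ a).map_smul c b)

/-- The linear map on the tensor product induced by an unbundled bilinear map. -/
def swLift {f : V → W → Z} (h₁ : ∀ w, IsLinearMap k fun v => f v w)
    (h₂ : ∀ v, IsLinearMap k fun w => f v w) : V ⊗[k] W →ₗ[k] Z :=
  TensorProduct.lift (mkBilin f h₁ h₂)

theorem sw_eq_lift {f : V → W → Z} (h₁ : ∀ w, IsLinearMap k fun v => f v w)
    (h₂ : ∀ v, IsLinearMap k fun w => f v w) (t : V ⊗[k] W) : sw t f = swLift h₁ h₂ t := by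
  conv_rhs => rw [(TensorProduct.exists_finset t).choose_spec]
  simp [sw, swLift, mkBilin]

theorem sw_tmul {f : V → W → Z} (h₁ : ∀ w, IsLinearMap k fun v => f v w)
    (h₂ : ∀ v, IsLinearMap k fun w => f v w) (v : V) (w : W) : sw (v ⊗ₜ[k] w) f = f v w := by
  simp [sw_eq_lift h₁ h₂, swLift, mkBilin]

theorem sw_tmul_eq_self (t : V ⊗[k] W) : (sw t fun v w => v ⊗ₜ[k] w) = t :=
  (TensorProduct.exists_finset t).choose_spec.symm

@[fun_prop]
theorem isLinearMap_sw {f : U → V → W → Z} (t : V ⊗[k] W)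
    (h : ∀ v w, IsLinearMap k fun u => f u v w) : IsLinearMap k fun u => sw t (f u) :=
  ⟨fun x y => by simp only [sw, (h _ _).map_add, Finset.sum_add_distrib],
    fun c x => by simp only [sw, (h _ _).map_smul, Finset.smul_sum]⟩

@[fun_prop]
theorem isLinearMap_sw_left {t : U → V ⊗[k] W} {f : V → W → Z} (ht : IsLinearMap k t)
    (h₁ : ∀ w, IsLinearMap k fun v => f v w) (h₂ : ∀ v, IsLinearMap k fun w => f v w) :
    IsLinearMap k fun u => sw (t u) f := by
  simp only [sw_eq_lift h₁ h₂]
  fun_prop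

theorem map_sw {g : Z → Y} (hg : IsLinearMap k g) (t : V ⊗[k] W) (f : V → W → Z) :
    g (sw t f) = sw t fun v w => g (f v w) := map_sum (hg.mk' g) _ _

theorem sw_sw {f : V → W → U ⊗[k] Z} {g : U → Z → Y} (h₁ : ∀ w, IsLinearMap k fun v => g v w)
    (h₂ : ∀ v, IsLinearMap k fun w => g v w) (t : V ⊗[k] W) :
    sw (sw t f) g = sw t fun v w => sw (f v w) g := by
  simp only [sw_eq_lift h₁ h₂]
  exact map_sum _ _ _

theorem sw_smul_left {f : V → W → Z} (h₁ : ∀ w, IsLinearMap k fun v => f v w)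
    (h₂ : ∀ v, IsLinearMap k fun w => f v w) (c : k) (t : V ⊗[k] W) :
    sw (c • t) f = c • sw t f := by
  simp only [sw_eq_lift h₁ h₂, map_smul]

-- Only an exchange of finite sums, so no linearity is needed; this is what allows reordering under
-- binders.
omit [Module k Z] in
theorem sw_comm {V' W' : Type*} [AddCommMonoid V'] [Module k V'] [AddCommMonoid W'] [Module k W']
    (t : V ⊗[k] W) (s : V' ⊗[k] W') (f : V → W → V' → W' → Z) :
    (sw t fun v w => sw s fun v' w' => f v w v' w') =
      sw s fun v' w' => sw t fun v w => f v w v' w' := Finset.sum_comm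

theorem sw_mul {A : Type*} [NonUnitalNonAssocSemiring A] (t : V ⊗[k] W) (f : V → W → A) (a : A) :
    sw t f * a = sw t fun v w => f v w * a := Finset.sum_mul _ _ _

theorem mul_sw {A : Type*} [NonUnitalNonAssocSemiring A] (t : V ⊗[k] W) (f : V → W → A) (a : A) :
    a * sw t f = sw t fun v w => a * f v w := Finset.mul_sum _ _ _

theorem sw_tmul_right (t : V ⊗[k] W) (f : V → W → Z) (y : Y) :
    sw t f ⊗ₜ[k] y = sw t fun v w => f v w ⊗ₜ[k] y := TensorProduct.sum_tmul _ _ _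

theorem tmul_sw (t : V ⊗[k] W) (f : V → W → Z) (y : Y) :
    y ⊗ₜ[k] sw t f = sw t fun v w => y ⊗ₜ[k] f v w := TensorProduct.tmul_sum _ _ _

theorem smul_sw (t : V ⊗[k] W) (f : V → W → Z) (c : k) :
    c • sw t f = sw t fun v w => c • f v w := Finset.smul_sum

theorem sw_smul (t : V ⊗[k] W) (f : V → W → k) (z : Z) :
    sw t f • z = sw t fun v w => f v w • z := Finset.sum_smul

theorem lin_sw (g : Z →ₗ[k] Y) (t : V ⊗[k] W) (f : V → W → Z) :
    g (sw t f) = sw t fun v w => g (f v w) := map_sum _ _ _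

theorem lin_sw_apply {X : Type*} [AddCommMonoid X] [Module k X] (g : Z →ₗ[k] X →ₗ[k] Y)
    (t : V ⊗[k] W) (f : V → W → Z) (x : X) :
    g (sw t f) x = sw t fun v w => g (f v w) x := by
  simp [sw]

theorem sw_sum {ι : Type*} (s : Finset ι) (v : ι → V) (w : ι → W) {f : V → W → Z}
    (h₁ : ∀ w, IsLinearMap k fun v => f v w) (h₂ : ∀ v, IsLinearMap k fun w => f v w) :
    sw (∑ i ∈ s, v i ⊗ₜ[k] w i) f = ∑ i ∈ s, f (v i) (w i) := by
  simp only [sw_eq_lift h₁ h₂, map_sum, swLift, mkBilin, TensorProduct.lift.tmul, LinearMap.mk₂_apply]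

/-- The maps `α` and `β` are kept independent so that one statement covers coassociativity of `Δ`
(`α = β = Δ`) and of a right comodule (`α` the coaction, `β = Δ`). -/
theorem sw_assoc {V₁ W₁ : Type*} [AddCommMonoid V₁] [Module k V₁] [AddCommMonoid W₁] [Module k W₁]
    {α : V →ₗ[k] V₁ ⊗[k] W₁} {β : W →ₗ[k] W₁ ⊗[k] U} {t : V ⊗[k] U} {s : V₁ ⊗[k] W}
    (h : TensorProduct.assoc k V₁ W₁ U (α.rTensor U t) = β.lTensor V₁ s) {f : V₁ → W₁ → U → Z}
    (h₁ : ∀ b c, IsLinearMap k fun a => f a b c) (h₂ : ∀ a c, IsLinearMap k fun b => f a b c)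
    (h₃ : ∀ a b, IsLinearMap k fun c => f a b c) :
    (sw t fun a c => sw (α a) fun a b => f a b c) = sw s fun a b => sw (β b) fun b c => f a b c := by
  have hL : (sw t fun a c => sw (α a) fun a b => f a b c) =
      sw (TensorProduct.assoc k V₁ W₁ U (α.rTensor U t)) fun a x => sw x fun b c => f a b c := by
    conv_rhs => rw [← sw_tmul_eq_self t]
    simp (disch := fun_prop) only [lin_sw, LinearMap.rTensor_tmul]
    rw [map_sw (g := TensorProduct.assoc k V₁ W₁ U) (LinearEquiv.toLinearMap _).isLinear]
    rw [sw_sw (by fun_prop) (by fun_prop)]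
    congr! with a c
    conv_rhs => rw [← sw_tmul_eq_self (α a)]
    simp (disch := fun_prop) only [sw_tmul_right]
    rw [map_sw (g := TensorProduct.assoc k V₁ W₁ U) (LinearEquiv.toLinearMap _).isLinear]
    simp (disch := fun_prop) only [TensorProduct.assoc_tmul, sw_sw, sw_tmul]
  have hR : (sw s fun a b => sw (β b) fun b c => f a b c) =
      sw (β.lTensor V₁ s) fun a x => sw x fun b c => f a b c := by
    conv_rhs => rw [← sw_tmul_eq_self s]
    simp (disch := fun_prop) only [lin_sw, LinearMap.lTensor_tmul, sw_sw, sw_tmul]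
  rw [hL, hR, h]

omit [Module k Z] in
theorem sw_congr {t : V ⊗[k] W} {f g : V → W → Z} (h : ∀ v w, f v w = g v w) : sw t f = sw t g :=
  congrArg _ (funext₂ h)

theorem sw_apply {X : Type*} [AddCommMonoid X] [Module k X] (t : V ⊗[k] W)
    (f : V → W → X →ₗ[k] Y) (x : X) : sw t f x = sw t fun v w => f v w x := by
  simp [sw]

end Sweedler

/-! ### Sweedler calculus in a Hopf algebra -/

section Hopf

variable {k H Z : Type*} [Field k] [Ring H] [HopfAlgebra k H] [AddCommGroup Z] [Module k Z]

local notation "Δ" => Coalgebra.comul (R := k)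
local notation "ε" => Coalgebra.counit (R := k)
local notation "𝑆" => HopfAlgebra.antipode k

theorem sw_comul_assoc (x : H) {f : H → H → H → Z}
    (h₁ : ∀ b c, IsLinearMap k fun a => f a b c) (h₂ : ∀ a c, IsLinearMap k fun b => f a b c)
    (h₃ : ∀ a b, IsLinearMap k fun c => f a b c) :
    (sw (Δ x) fun a c => sw (Δ a) fun a b => f a b c) =
      sw (Δ x) fun a b => sw (Δ b) fun b c => f a b c :=
  sw_assoc (Coalgebra.coassoc_apply x) h₁ h₂ h₃

/-- Complements `sw_comul_assoc` when an unrelated sum separates the two comultiplications. Used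
together as rewrite rules, they bring iterated coproducts into right-nested form. -/
theorem sw_comul_assoc_comm (x : H) {f : H → H → H → H → Z}
    (h₁ : ∀ b c d, IsLinearMap k fun a => f a b c d) (h₂ : ∀ a c d, IsLinearMap k fun b => f a b c d)
    (h₃ : ∀ a b d, IsLinearMap k fun c => f a b c d)
    (h₄ : ∀ a b c, IsLinearMap k fun d => f a b c d) :
    (sw (Δ x) fun p q => sw (Δ q) fun c d => sw (Δ p) fun a b => f a b c d) =
      sw (Δ x) fun a b => sw (Δ b) fun b c => sw (Δ c) fun c d => f a b c d := by
  rw [← sw_comul_assoc (k := k) x (f := fun a b c => sw (Δ c) fun c d => f a b c d)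
    (by fun_prop) (by fun_prop) (by fun_prop)]
  exact sw_congr fun _ _ => sw_comm _ _ _

theorem sw_counit_smul (x : H) {f : H → Z} (hf : IsLinearMap k f) :
    (sw (Δ x) fun a b => ε a • f b) = f x := by
  have h := congrArg (fun t => sw t fun (c : k) b => c • f b) (Coalgebra.rTensor_counit_comul (R := k) x)
  rw [sw_tmul (by fun_prop) (by fun_prop), one_smul] at h
  rw [← h]
  conv_rhs => rw [← sw_tmul_eq_self (Δ x)]
  simp (disch := fun_prop) only [lin_sw, LinearMap.rTensor_tmul, sw_sw, sw_tmul]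

theorem sw_smul_counit (x : H) {f : H → Z} (hf : IsLinearMap k f) :
    (sw (Δ x) fun a b => ε b • f a) = f x := by
  have h := congrArg (fun t => sw t fun b (c : k) => c • f b) (Coalgebra.lTensor_counit_comul (R := k) x)
  rw [sw_tmul (by fun_prop) (by fun_prop), one_smul] at h
  rw [← h]
  conv_rhs => rw [← sw_tmul_eq_self (Δ x)]
  simp (disch := fun_prop) only [lin_sw, LinearMap.lTensor_tmul, sw_sw, sw_tmul]

theorem sw_antipode_mul (x : H) {f : H → Z} (hf : IsLinearMap k f) :
    (sw (Δ x) fun a b => f (𝑆 a * b)) = ε x • f 1 := by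
  have h := HopfAlgebra.mul_antipode_rTensor_comul_apply (R := k) x
  rw [← sw_tmul_eq_self (Δ x)] at h
  simp only [lin_sw, LinearMap.rTensor_tmul, LinearMap.mul'_apply] at h
  rw [← map_sw hf, h, Algebra.algebraMap_eq_smul_one, hf.map_smul]

theorem sw_mul_antipode (x : H) {f : H → Z} (hf : IsLinearMap k f) :
    (sw (Δ x) fun a b => f (a * 𝑆 b)) = ε x • f 1 := by
  have h := HopfAlgebra.mul_antipode_lTensor_comul_apply (R := k) x
  rw [← sw_tmul_eq_self (Δ x)] at h
  simp only [lin_sw, LinearMap.lTensor_tmul, LinearMap.mul'_apply] at h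
  rw [← map_sw hf, h, Algebra.algebraMap_eq_smul_one, hf.map_smul]

theorem sw_comul_mul (x y : H) {f : H → H → Z} (h₁ : ∀ b, IsLinearMap k fun a => f a b)
    (h₂ : ∀ a, IsLinearMap k fun b => f a b) :
    sw (Δ (x * y)) f =
      sw (Δ x) fun x₁ x₂ => sw (Δ y) fun y₁ y₂ => f (x₁ * y₁) (x₂ * y₂) := by
  rw [Bialgebra.comul_mul]
  conv_lhs => rw [← sw_tmul_eq_self (Δ x), ← sw_tmul_eq_self (Δ y)]
  simp (disch := fun_prop) only [sw_mul, mul_sw, Algebra.TensorProduct.tmul_mul_tmul, sw_sw, sw_tmul]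
  exact sw_comm _ _ _

theorem sw_comul_one {f : H → H → Z} (h₁ : ∀ b, IsLinearMap k fun a => f a b)
    (h₂ : ∀ a, IsLinearMap k fun b => f a b) :
    sw (Δ (1 : H)) f = f 1 1 := by
  rw [Bialgebra.comul_one, Algebra.TensorProduct.one_def, sw_tmul h₁ h₂]

/-- In the convolution algebra Hom(H, H ⊗ H), the left side is a left inverse of Δ (`h1`) and the
right side a right inverse (`h2`), so they agree. -/
theorem comul_antipode (x : H) : Δ (𝑆 x) = sw (Δ x) fun a b => 𝑆 b ⊗ₜ[k] 𝑆 a := by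
  have h1 (x : H) : (sw (Δ x) fun a b => Δ (𝑆 a) * Δ b) = ε x • 1 := by
    simp only [← Bialgebra.comul_mul]
    rw [sw_antipode_mul x (f := fun z => Δ z) (by fun_prop), Bialgebra.comul_one]
  have h2 (x : H) : (sw (Δ x) fun a b => Δ a * sw (Δ b) fun c d => 𝑆 d ⊗ₜ[k] 𝑆 c) = ε x • 1 := by
    calc _ = sw (Δ x) fun a b => sw (Δ a) fun p q => sw (Δ b) fun c d =>
          (p * 𝑆 d) ⊗ₜ[k] (q * 𝑆 c) := by
          refine sw_congr fun a b => ?_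
          conv_lhs => rw [← sw_tmul_eq_self (Δ a)]
          simp only [sw_mul, mul_sw, Algebra.TensorProduct.tmul_mul_tmul]
          exact sw_comm _ _ _
      _ = sw (Δ x) fun p b => sw (Δ b) fun b d => sw (Δ b) fun q c =>
          (p * 𝑆 d) ⊗ₜ[k] (q * 𝑆 c) := by
          simp (disch := fun_prop) only [sw_comul_assoc]
      _ = sw (Δ x) fun p d => (p * 𝑆 d) ⊗ₜ[k] 1 := by
          refine sw_congr fun p b => ?_
          rw [← sw_counit_smul b (f := fun d => (p * 𝑆 d) ⊗ₜ[k] (1 : H)) (by fun_prop)]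
          refine sw_congr fun b d => ?_
          exact sw_mul_antipode b (f := fun z => (p * 𝑆 d) ⊗ₜ[k] z) (by fun_prop)
      _ = _ := by
          rw [sw_mul_antipode x (f := fun z => z ⊗ₜ[k] (1 : H)) (by fun_prop),
            Algebra.TensorProduct.one_def]
  calc Δ (𝑆 x) = sw (Δ x) fun a b => Δ (𝑆 a) * (ε b • 1) := by
        rw [← sw_smul_counit (k := k) x (f := fun z => Δ (𝑆 z)) (by fun_prop)]
        simp
    _ = sw (Δ x) fun a b => (sw (Δ a) fun a c => Δ (𝑆 a) * Δ c) * sw (Δ b) fun c d => 𝑆 d ⊗ₜ[k] 𝑆 c := by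
        simp only [← h2, mul_sw]
        rw [← sw_comul_assoc (k := k) x (f := fun a c b =>
          sw (Δ b) fun v w => Δ (𝑆 a) * (Δ c * 𝑆 w ⊗ₜ[k] 𝑆 v))
          (by fun_prop) (by fun_prop) (by fun_prop)]
        refine sw_congr fun a b => ?_
        simp only [sw_mul, mul_assoc]
        exact sw_comm _ _ _
    _ = _ := by
        simp only [h1, smul_mul_assoc, one_mul]
        rw [sw_counit_smul x (f := fun b => sw (Δ b) fun c d => 𝑆 d ⊗ₜ[k] 𝑆 c) (by fun_prop)]

theorem sw_comul_antipode (x : H) {f : H → H → Z} (h₁ : ∀ b, IsLinearMap k fun a => f a b)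
    (h₂ : ∀ a, IsLinearMap k fun b => f a b) :
    sw (Δ (𝑆 x)) f = sw (Δ x) fun a b => f (𝑆 b) (𝑆 a) := by
  simp (disch := fun_prop) only [comul_antipode, sw_sw, sw_tmul]

/-- Coassociativity of the coalgebra `H ⊗ H`. -/
theorem sw_comul_assoc₂ (x y : H) {f : H → H → H → H → H → H → Z}
    (h₁ : ∀ b c d e g, IsLinearMap k fun a => f a b c d e g)
    (h₂ : ∀ a c d e g, IsLinearMap k fun b => f a b c d e g)
    (h₃ : ∀ a b d e g, IsLinearMap k fun c => f a b c d e g)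
    (h₄ : ∀ a b c e g, IsLinearMap k fun d => f a b c d e g)
    (h₅ : ∀ a b c d g, IsLinearMap k fun e => f a b c d e g)
    (h₆ : ∀ a b c d e, IsLinearMap k fun g => f a b c d e g) :
    (sw (Δ x) fun a c => sw (Δ y) fun a' c' => sw (Δ a) fun a b => sw (Δ a') fun a' b' =>
        f a a' b b' c c') =
      sw (Δ x) fun a c => sw (Δ y) fun a' c' => sw (Δ c) fun b c => sw (Δ c') fun b' c' =>
        f a a' b b' c c' := by
  calc _ = sw (Δ x) fun a c => sw (Δ a) fun a b => sw (Δ y) fun a' c' => sw (Δ a') fun a' b' =>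
        f a a' b b' c c' := sw_congr fun a c => sw_comm _ _ _
    _ = sw (Δ x) fun a c => sw (Δ c) fun b c => sw (Δ y) fun a' c' => sw (Δ c') fun b' c' =>
        f a a' b b' c c' := by
        simp (disch := fun_prop) only [sw_comul_assoc]
    _ = _ := sw_congr fun a c => sw_comm _ _ _

end Hopf

/-! ### Coquasitriangular forms and bijectivity of the antipode -/

section CQT

variable {k H Z : Type*} [Field k] [Ring H] [HopfAlgebra k H] [AddCommGroup Z] [Module k Z]

local notation "Δ" => Coalgebra.comul (R := k)
local notation "ε" => Coalgebra.counit (R := k)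
local notation "𝑆" => HopfAlgebra.antipode k

namespace CQTStructure

variable (R : CQTStructure k H)

local notation "σ" => CQTStructure.form R
local notation "τ" => CQTStructure.inv R

theorem sw_form_inv (h g : H) :
    (sw (Δ h) fun h₁ h₂ => sw (Δ g) fun g₁ g₂ => σ h₁ g₁ * τ h₂ g₂) = ε h * ε g := by
  obtain ⟨n, u, v, hu⟩ := TensorProduct.exists_sum_tmul_eq (Δ h)
  obtain ⟨m, u', v', hu'⟩ := TensorProduct.exists_sum_tmul_eq (Δ g)
  rw [← R.form_mul_inv h g u v u' v' hu hu', hu, hu']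
  simp (disch := fun_prop) only [sw_sum]

theorem sw_inv_form (h g : H) :
    (sw (Δ h) fun h₁ h₂ => sw (Δ g) fun g₁ g₂ => τ h₁ g₁ * σ h₂ g₂) = ε h * ε g := by
  obtain ⟨n, u, v, hu⟩ := TensorProduct.exists_sum_tmul_eq (Δ h)
  obtain ⟨m, u', v', hu'⟩ := TensorProduct.exists_sum_tmul_eq (Δ g)
  rw [← R.inv_mul_form h g u v u' v' hu hu', hu, hu']
  simp (disch := fun_prop) only [sw_sum]

theorem form_mul_left (h h' g : H) :
    σ (h * h') g = sw (Δ g) fun g₁ g₂ => σ h g₁ * σ h' g₂ := by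
  obtain ⟨n, u, v, hu⟩ := TensorProduct.exists_sum_tmul_eq (Δ g)
  rw [R.mul_left h h' g u v hu, hu]
  simp (disch := fun_prop) only [sw_sum]

theorem form_mul_right (g h h' : H) :
    σ g (h * h') = sw (Δ g) fun g₁ g₂ => σ g₂ h * σ g₁ h' := by
  obtain ⟨n, u, v, hu⟩ := TensorProduct.exists_sum_tmul_eq (Δ g)
  rw [R.mul_right g h h' u v hu, hu]
  simp (disch := fun_prop) only [sw_sum]

theorem sw_form_comm (h g : H) {f : H → Z} (hf : IsLinearMap k f) :
    (sw (Δ h) fun h₁ h₂ => sw (Δ g) fun g₁ g₂ => σ h₁ g₁ • f (h₂ * g₂)) =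
      sw (Δ h) fun h₁ h₂ => sw (Δ g) fun g₁ g₂ => σ h₂ g₂ • f (g₁ * h₁) := by
  obtain ⟨n, u, v, hu⟩ := TensorProduct.exists_sum_tmul_eq (Δ h)
  obtain ⟨m, u', v', hu'⟩ := TensorProduct.exists_sum_tmul_eq (Δ g)
  have := congrArg (hf.mk' f) (R.comm h g u v u' v' hu hu')
  rw [hu, hu']
  simp (disch := fun_prop) only [sw_sum]
  simpa only [map_sum, map_smul, IsLinearMap.mk'_apply] using this

theorem sw_form_inv_smul (h g : H) (z : Z) :
    (sw (Δ h) fun h₁ h₂ => sw (Δ g) fun g₁ g₂ => σ h₁ g₁ • τ h₂ g₂ • z) = ε h • ε g • z := by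
  simp only [smul_smul, ← sw_smul, sw_form_inv]

theorem sw_inv_form_smul (h g : H) (z : Z) :
    (sw (Δ h) fun h₁ h₂ => sw (Δ g) fun g₁ g₂ => τ h₁ g₁ • σ h₂ g₂ • z) = ε h • ε g • z := by
  simp only [smul_smul, ← sw_smul, sw_inv_form]

theorem sw_inv_form_cancel (h g : H) {f : H → H → Z} (h₁ : ∀ b, IsLinearMap k fun a => f a b)
    (h₂ : ∀ a, IsLinearMap k fun b => f a b) :
    (sw (Δ h) fun h₁ h₂ => sw (Δ g) fun g₁ g₂ => sw (Δ h₂) fun h₂ h₃ => sw (Δ g₂) fun g₂ g₃ =>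
      τ h₁ g₁ • σ h₂ g₂ • f h₃ g₃) = f h g := by
  rw [← sw_comul_assoc₂ (k := k) h g (f := fun a a' b b' c c' => τ a a' • σ b b' • f c c')
    (by fun_prop) (by fun_prop) (by fun_prop) (by fun_prop) (by fun_prop) (by fun_prop)]
  simp only [sw_inv_form_smul, ← smul_sw]
  simp (disch := fun_prop) only [sw_counit_smul]

theorem sw_form_inv_cancel_right (h g : H) {f : H → H → Z}
    (h₁ : ∀ b, IsLinearMap k fun a => f a b) (h₂ : ∀ a, IsLinearMap k fun b => f a b) :
    (sw (Δ h) fun h₁ h₂ => sw (Δ g) fun g₁ g₂ => sw (Δ h₂) fun h₂ h₃ => sw (Δ g₂) fun g₂ g₃ =>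
      σ h₂ g₂ • τ h₃ g₃ • f h₁ g₁) = f h g := by
  simp only [sw_form_inv_smul, ← smul_sw]
  simp (disch := fun_prop) only [sw_smul_counit]

/-- The commutation axiom reads σ ∗ m = mᵒᵖ ∗ σ in convolution notation; multiplying by τ on both
sides gives τ ∗ mᵒᵖ = m ∗ τ. -/
theorem sw_inv_comm (h g : H) {f : H → Z} (hf : IsLinearMap k f) :
    (sw (Δ h) fun h₁ h₂ => sw (Δ g) fun g₁ g₂ => τ h₁ g₁ • f (g₂ * h₂)) =
      sw (Δ h) fun h₁ h₂ => sw (Δ g) fun g₁ g₂ => τ h₂ g₂ • f (h₁ * g₁) := by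
  symm
  rw [← R.sw_inv_form_cancel h g (f := fun h g => sw (Δ h) fun h₁ h₂ => sw (Δ g) fun g₁ g₂ =>
    τ h₂ g₂ • f (h₁ * g₁)) (by fun_prop) (by fun_prop)]
  refine sw_congr fun h₁ h => sw_congr fun g₁ g => ?_
  calc _ = τ h₁ g₁ • (sw (Δ h) fun h₂ h₃ => sw (Δ g) fun g₂ g₃ => sw (Δ h₃) fun h₃ h₄ =>
        sw (Δ g₃) fun g₃ g₄ => σ h₂ g₂ • τ h₄ g₄ • f (h₃ * g₃)) := by simp only [smul_sw]
    _ = τ h₁ g₁ • (sw (Δ h) fun h₂ h₃ => sw (Δ g) fun g₂ g₃ => sw (Δ h₂) fun h₂ h₄ =>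
        sw (Δ g₂) fun g₂ g₄ => σ h₂ g₂ • τ h₃ g₃ • f (h₄ * g₄)) := by
        rw [sw_comul_assoc₂ (k := k) h g (f := fun a a' b b' c c' =>
          σ a a' • τ c c' • f (b * b')) (by fun_prop) (by fun_prop) (by fun_prop) (by fun_prop)
          (by fun_prop) (by fun_prop)]
    _ = τ h₁ g₁ • (sw (Δ h) fun h₂ h₃ => sw (Δ g) fun g₂ g₃ => sw (Δ h₂) fun h₂ h₄ =>
        sw (Δ g₂) fun g₂ g₄ => σ h₄ g₄ • τ h₃ g₃ • f (g₂ * h₂)) := by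
        congr 1
        refine sw_congr fun h₂ h₃ => sw_congr fun g₂ g₃ => ?_
        exact R.sw_form_comm h₂ g₂ (f := fun z => τ h₃ g₃ • f z) (by fun_prop)
    _ = _ := by
        rw [sw_comul_assoc₂ (k := k) h g (f := fun a a' b b' c c' =>
          σ b b' • τ c c' • f (a' * a)) (by fun_prop) (by fun_prop) (by fun_prop) (by fun_prop)
          (by fun_prop) (by fun_prop)]
        rw [R.sw_form_inv_cancel_right h g (f := fun h g => f (g * h)) (by fun_prop) (by fun_prop)]

/-- Multiplicativity in the first slot gives σ(h₁, g₁)σ(S(h₂), g₂) = σ(h₁S(h₂), g) = ε(h)ε(g), and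
inverses are unique. -/
theorem form_antipode_left (h g : H) : σ (𝑆 h) g = τ h g := by
  rw [← R.sw_inv_form_cancel h g (f := fun h g => σ (𝑆 h) g) (by fun_prop) (by fun_prop)]
  calc _ = sw (Δ h) fun h₁ h₂ => sw (Δ g) fun g₁ g₂ => τ h₁ g₁ • sw (Δ h₂) fun h₂ h₃ =>
        σ (h₂ * 𝑆 h₃) g₂ := by
        refine sw_congr fun h₁ h₂ => sw_congr fun g₁ g₂ => ?_
        simp only [form_mul_left, smul_eq_mul, mul_sw]
    _ = sw (Δ h) fun h₁ h₂ => sw (Δ g) fun g₁ g₂ => ε h₂ • ε g₂ • τ h₁ g₁ := by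
        refine sw_congr fun h₁ h₂ => sw_congr fun g₁ g₂ => ?_
        rw [sw_mul_antipode h₂ (f := fun z => σ z g₂) (by fun_prop), R.one_left]
        simp only [smul_eq_mul]; ring
    _ = _ := by
        simp only [← smul_sw]
        simp (disch := fun_prop) only [sw_smul_counit]

/-- The functional `x ↦ σ⁻¹(S(x₁), x₂)`, which implements the square of the antipode. -/
def drinfeld : H →ₗ[k] k :=
  IsLinearMap.mk' (fun x => sw (Δ x) fun a b => τ (𝑆 a) b) (by fun_prop)

/-- The functional `x ↦ σ(x₁, S(x₂))`, the convolution inverse of `drinfeld`. -/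
def drinfeldInv : H →ₗ[k] k :=
  IsLinearMap.mk' (fun x => sw (Δ x) fun a b => σ a (𝑆 b)) (by fun_prop)

theorem drinfeld_apply (x : H) : R.drinfeld x = sw (Δ x) fun a b => τ (𝑆 a) b := rfl

theorem drinfeldInv_apply (x : H) : R.drinfeldInv x = sw (Δ x) fun a b => σ a (𝑆 b) := rfl

/-- Expanding u gives τ(S(x₂), x₃) x₄S(x₁), one side of the commutation rule for the pair S(p), q
with p ⊗ q = Δ(x). The other side is τ(S(x₁), x₄) S(x₂)x₃, where the product collapses. -/
theorem sw_drinfeld_mul_antipode (x : H) {f : H → Z} (hf : IsLinearMap k f) :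
    (sw (Δ x) fun a b => sw (Δ b) fun b c => R.drinfeld b • f (c * 𝑆 a)) =
      R.drinfeld x • f 1 := by
  calc _ = sw (Δ x) fun p q => sw (Δ (𝑆 p)) fun h₁ h₂ => sw (Δ q) fun g₁ g₂ =>
        τ h₁ g₁ • f (g₂ * h₂) := by
        simp (disch := fun_prop) only [drinfeld_apply, sw_comul_antipode, sw_smul, sw_comul_assoc]
    _ = sw (Δ x) fun p q => sw (Δ (𝑆 p)) fun h₁ h₂ => sw (Δ q) fun g₁ g₂ =>
        τ h₂ g₂ • f (h₁ * g₁) := sw_congr fun p q => R.sw_inv_comm _ _ hf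
    _ = sw (Δ x) fun a c => sw (Δ c) fun b c => sw (Δ b) fun b₁ b₂ =>
        τ (𝑆 a) c • f (𝑆 b₁ * b₂) := by
        simp (disch := fun_prop) only [sw_comul_antipode, sw_comul_assoc]
    _ = _ := by
        have (a b c : H) : (sw (Δ b) fun b₁ b₂ => τ (𝑆 a) c • f (𝑆 b₁ * b₂)) =
            ε b • τ (𝑆 a) c • f 1 :=
          sw_antipode_mul b (f := fun z => τ (𝑆 a) c • f z) (by fun_prop)
        simp (disch := fun_prop) only [this, sw_counit_smul, drinfeld_apply, sw_smul]

/-- By the previous identity u(x₂)S²(x₁) = u(x₃) x₄S(x₂)S²(x₁), and S(x₂)S²(x₁) = S(S(x₁)x₂)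
cancels. -/
theorem sw_drinfeld_smul (x : H) {f : H → Z} (hf : IsLinearMap k f) :
    (sw (Δ x) fun a b => R.drinfeld b • f (𝑆 (𝑆 a))) =
      sw (Δ x) fun a b => R.drinfeld a • f b := by
  calc _ = sw (Δ x) fun a b => sw (Δ b) fun b c => sw (Δ c) fun c d =>
        R.drinfeld c • f (d * 𝑆 b * 𝑆 (𝑆 a)) := by
        refine sw_congr fun a b => ?_
        rw [R.sw_drinfeld_mul_antipode b (f := fun z => f (z * 𝑆 (𝑆 a))) (by fun_prop), one_mul]
    _ = sw (Δ x) fun a b => sw (Δ b) fun c d => sw (Δ a) fun a₁ a₂ =>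
        R.drinfeld c • f (d * 𝑆 (𝑆 a₁ * a₂)) := by
        simp (disch := fun_prop) only [HopfAlgebra.antipode_mul_antidistrib, mul_assoc]
        rw [← sw_comul_assoc (k := k) x (f := fun a b c => sw (Δ c) fun c d =>
          R.drinfeld c • f (d * (𝑆 b * 𝑆 (𝑆 a)))) (by fun_prop) (by fun_prop) (by fun_prop)]
        exact sw_congr fun a b => sw_comm _ _ _
    _ = _ := by
        have (a c d : H) : (sw (Δ a) fun a₁ a₂ => R.drinfeld c • f (d * 𝑆 (𝑆 a₁ * a₂))) =
            ε a • R.drinfeld c • f d := by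
          rw [sw_antipode_mul a (f := fun z => R.drinfeld c • f (d * 𝑆 z)) (by fun_prop),
            HopfAlgebra.antipode_one, mul_one]
        simp (disch := fun_prop) only [this, ← smul_sw, sw_counit_smul]

theorem sw_antipode_mul_drinfeldInv (x : H) {f : H → Z} (hf : IsLinearMap k f) :
    (sw (Δ x) fun a b => sw (Δ b) fun b c => R.drinfeldInv b • f (𝑆 c * a)) =
      R.drinfeldInv x • f 1 := by
  calc _ = sw (Δ x) fun p q => sw (Δ p) fun h₁ h₂ => sw (Δ (𝑆 q)) fun g₁ g₂ =>
        σ h₂ g₂ • f (g₁ * h₁) := by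
        simp (disch := fun_prop) only [drinfeldInv_apply, sw_comul_antipode, sw_smul,
          sw_comul_assoc]
    _ = sw (Δ x) fun p q => sw (Δ p) fun h₁ h₂ => sw (Δ (𝑆 q)) fun g₁ g₂ =>
        σ h₁ g₁ • f (h₂ * g₂) := sw_congr fun p q => (R.sw_form_comm _ _ hf).symm
    _ = sw (Δ x) fun a c => sw (Δ c) fun b c => sw (Δ b) fun b₁ b₂ =>
        σ a (𝑆 c) • f (b₁ * 𝑆 b₂) := by
        simp (disch := fun_prop) only [sw_comul_antipode, sw_comul_assoc]
    _ = _ := by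
        have (a b c : H) : (sw (Δ b) fun b₁ b₂ => σ a (𝑆 c) • f (b₁ * 𝑆 b₂)) =
            ε b • σ a (𝑆 c) • f 1 :=
          sw_mul_antipode b (f := fun z => σ a (𝑆 c) • f z) (by fun_prop)
        simp (disch := fun_prop) only [this, sw_counit_smul, drinfeldInv_apply, sw_smul]

theorem sw_drinfeldInv_smul (x : H) {f : H → Z} (hf : IsLinearMap k f) :
    (sw (Δ x) fun a b => R.drinfeldInv a • f (𝑆 (𝑆 b))) =
      sw (Δ x) fun a b => R.drinfeldInv b • f a := by
  calc _ = sw (Δ x) fun d e => sw (Δ d) fun a b => sw (Δ b) fun b c =>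
        R.drinfeldInv b • f (𝑆 (𝑆 e) * (𝑆 c * a)) := by
        refine sw_congr fun a b => ?_
        rw [R.sw_antipode_mul_drinfeldInv a (f := fun z => f (𝑆 (𝑆 b) * z)) (by fun_prop), mul_one]
    _ = sw (Δ x) fun a b => sw (Δ b) fun b c => sw (Δ c) fun c d =>
        R.drinfeldInv b • f (𝑆 (c * 𝑆 d) * a) := by
        simp (disch := fun_prop) only [HopfAlgebra.antipode_mul_antidistrib, mul_assoc,
          sw_comul_assoc]
    _ = _ := by
        have (a b c : H) : (sw (Δ c) fun c d => R.drinfeldInv b • f (𝑆 (c * 𝑆 d) * a)) =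
            ε c • R.drinfeldInv b • f a := by
          rw [sw_mul_antipode c (f := fun z => R.drinfeldInv b • f (𝑆 z * a)) (by fun_prop),
            HopfAlgebra.antipode_one, one_mul]
        simp (disch := fun_prop) only [this, sw_smul_counit]

theorem drinfeld_eq (x : H) : R.drinfeld x = sw (Δ x) fun a b => σ (𝑆 (𝑆 a)) b := by
  simp only [drinfeld_apply, form_antipode_left]

/-- Moving u across replaces the argument x₂ of σ(x₂, S(x₃)) by its image under S². With u written
as σ(S²(x₁), x₂), the two values of σ merge into σ(S²(x₁), x₂S(x₃)). -/
theorem sw_drinfeld_drinfeldInv (x : H) :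
    (sw (Δ x) fun a b => R.drinfeld a * R.drinfeldInv b) = ε x := by
  calc _ = sw (Δ x) fun p c => sw (Δ p) fun a b => R.drinfeld a • σ b (𝑆 c) := by
        simp (disch := fun_prop) only [drinfeldInv_apply, smul_eq_mul, mul_sw, sw_comul_assoc]
    _ = sw (Δ x) fun p c => sw (Δ p) fun a b => R.drinfeld b • σ (𝑆 (𝑆 a)) (𝑆 c) :=
        sw_congr fun p c => (R.sw_drinfeld_smul p (f := fun z => σ z (𝑆 c)) (by fun_prop)).symm
    _ = sw (Δ x) fun p q => sw (Δ q) fun b c => σ (𝑆 (𝑆 p)) (b * 𝑆 c) := by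
        simp (disch := fun_prop) only [drinfeld_eq, smul_eq_mul, sw_mul, form_mul_right,
          sw_comul_antipode, sw_comul_assoc, sw_comul_assoc_comm]
    _ = _ := by
        have (p q : H) : (sw (Δ q) fun b c => σ (𝑆 (𝑆 p)) (b * 𝑆 c)) = ε q • ε p := by
          rw [sw_mul_antipode q (f := fun z => σ (𝑆 (𝑆 p)) z) (by fun_prop), R.one_right]
          simp
        simp (disch := fun_prop) only [this, sw_smul_counit]

theorem sw_drinfeldInv_drinfeld (x : H) :
    (sw (Δ x) fun a b => R.drinfeldInv a * R.drinfeld b) = ε x := by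
  calc _ = sw (Δ x) fun p c => sw (Δ p) fun a b => R.drinfeldInv a • σ (𝑆 (𝑆 b)) c := by
        simp (disch := fun_prop) only [drinfeld_eq, smul_eq_mul, mul_sw, sw_comul_assoc]
    _ = sw (Δ x) fun p c => sw (Δ p) fun a b => R.drinfeldInv b • σ a c :=
        sw_congr fun p c => (R.sw_drinfeldInv_smul p (f := fun z => σ z c) (by fun_prop))
    _ = sw (Δ x) fun p q => sw (Δ q) fun b c => σ p (𝑆 b * c) := by
        simp (disch := fun_prop) only [drinfeldInv_apply, smul_eq_mul, sw_mul, form_mul_right,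
          sw_comul_assoc, sw_comul_assoc_comm]
    _ = _ := by
        have (p q : H) : (sw (Δ q) fun b c => σ p (𝑆 b * c)) = ε q • ε p := by
          rw [sw_antipode_mul q (f := fun z => σ p z) (by fun_prop), R.one_right]
        simp (disch := fun_prop) only [this, sw_smul_counit]

theorem antipode_bijective (R : CQTStructure k H) : Function.Bijective (𝑆 : H →ₗ[k] H) := by
  -- Translation by a convolution-invertible functional, on either side of the coproduct, is undone
  -- by translation by its inverse.
  have left {φ ψ : H →ₗ[k] k} (h : ∀ x, (sw (Δ x) fun a b => φ a * ψ b) = ε x) (x : H) :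
      (sw (Δ x) fun a b => φ a • sw (Δ b) fun b c => ψ b • c) = x := by
    simp only [smul_sw]
    rw [← sw_comul_assoc (k := k) x (f := fun a b c => φ a • ψ b • c) (by fun_prop) (by fun_prop)
      (by fun_prop)]
    simp only [smul_smul, ← sw_smul, h]
    exact sw_counit_smul x (by fun_prop)
  have right {φ ψ : H →ₗ[k] k} (h : ∀ x, (sw (Δ x) fun a b => φ a * ψ b) = ε x) (x : H) :
      (sw (Δ x) fun a b => ψ b • sw (Δ a) fun a b => φ b • a) = x := by
    simp (disch := fun_prop) only [smul_sw, sw_comul_assoc]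
    simp only [smul_smul, ← sw_smul, mul_comm (ψ _), h]
    exact sw_smul_counit x (by fun_prop)
  let L (φ : H →ₗ[k] k) : H →ₗ[k] H :=
    IsLinearMap.mk' (fun x => sw (Δ x) fun a b => φ a • b) (by fun_prop)
  let M (φ : H →ₗ[k] k) : H →ₗ[k] H :=
    IsLinearMap.mk' (fun x => sw (Δ x) fun a b => φ b • a) (by fun_prop)
  have hL : Function.Bijective (L R.drinfeld) := by
    refine Function.bijective_iff_has_inverse.2 ⟨L R.drinfeldInv, fun x => ?_, fun x => ?_⟩
    · change L R.drinfeldInv (sw (Δ x) fun a b => R.drinfeld a • b) = x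
      simp only [lin_sw, map_smul]
      exact left R.sw_drinfeld_drinfeldInv x
    · change L R.drinfeld (sw (Δ x) fun a b => R.drinfeldInv a • b) = x
      simp only [lin_sw, map_smul]
      exact left R.sw_drinfeldInv_drinfeld x
  have hM : Function.Bijective (M R.drinfeld) := by
    refine Function.bijective_iff_has_inverse.2 ⟨M R.drinfeldInv, fun x => ?_, fun x => ?_⟩
    · change M R.drinfeldInv (sw (Δ x) fun a b => R.drinfeld b • a) = x
      simp only [lin_sw, map_smul]
      exact right R.sw_drinfeldInv_drinfeld x
    · change M R.drinfeld (sw (Δ x) fun a b => R.drinfeldInv b • a) = x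
      simp only [lin_sw, map_smul]
      exact right R.sw_drinfeld_drinfeldInv x
  -- With both translations bijective, this forces S² to be bijective, hence S injective and
  -- surjective.
  have h : (fun x => 𝑆 (𝑆 x)) ∘ M R.drinfeld = L R.drinfeld := by
    funext x
    simp only [Function.comp_apply, L, M, lin_sw, map_smul, IsLinearMap.mk'_apply]
    exact R.sw_drinfeld_smul x (f := fun z => z) (by fun_prop)
  have h2 : Function.Bijective fun x : H => 𝑆 (𝑆 x) := (Function.Bijective.of_comp_iff _ hM).1 (h ▸ hL)
  exact ⟨Function.Injective.of_comp h2.1, Function.Surjective.of_comp h2.2⟩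

end CQTStructure

end CQT

/-! ### The inverse antipode and its behaviour under the form -/

section CQT

variable {k H Z : Type*} [Field k] [Ring H] [HopfAlgebra k H] [AddCommGroup Z] [Module k Z]

local notation "Δ" => Coalgebra.comul (R := k)
local notation "ε" => Coalgebra.counit (R := k)
local notation "𝑆" => HopfAlgebra.antipode k

namespace CQTStructure

variable (R : CQTStructure k H)

local notation "σ" => CQTStructure.form R
local notation "τ" => CQTStructure.inv R

/-- The inverse of the antipode of a coquasitriangular Hopf algebra. -/
def antipodeInv : H →ₗ[k] H :=
  (LinearEquiv.ofBijective (HopfAlgebra.antipode k : H →ₗ[k] H) R.antipode_bijective).symm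

local notation "𝑇" => CQTStructure.antipodeInv R

@[simp]
theorem antipode_antipodeInv (x : H) : 𝑆 (𝑇 x) = x :=
  (LinearEquiv.ofBijective (HopfAlgebra.antipode k : H →ₗ[k] H) R.antipode_bijective).apply_symm_apply x

@[simp]
theorem antipodeInv_antipode (x : H) : 𝑇 (𝑆 x) = x :=
  (LinearEquiv.ofBijective (HopfAlgebra.antipode k : H →ₗ[k] H) R.antipode_bijective).symm_apply_apply x

theorem antipodeInv_mul (x y : H) : 𝑇 (x * y) = 𝑇 y * 𝑇 x := by
  apply R.antipode_bijective.1
  rw [HopfAlgebra.antipode_mul_antidistrib]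
  simp

theorem antipodeInv_one : 𝑇 1 = 1 := by
  apply R.antipode_bijective.1
  rw [antipode_antipodeInv, HopfAlgebra.antipode_one]

theorem counit_antipodeInv (x : H) : ε (𝑇 x) = ε x := by
  rw [← HopfAlgebra.counit_antipode (R := k) (𝑇 x), antipode_antipodeInv]

theorem sw_comul_antipodeInv (x : H) {f : H → H → Z} (h₁ : ∀ b, IsLinearMap k fun a => f a b)
    (h₂ : ∀ a, IsLinearMap k fun b => f a b) :
    sw (Δ (𝑇 x)) f = sw (Δ x) fun a b => f (𝑇 b) (𝑇 a) := by
  conv_rhs => rw [← R.antipode_antipodeInv x]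
  simp (disch := fun_prop) only [sw_comul_antipode, antipodeInv_antipode]

theorem sw_antipodeInv_mul (x : H) {f : H → Z} (hf : IsLinearMap k f) :
    (sw (Δ x) fun a b => f (𝑇 b * a)) = ε x • f 1 := by
  rw [← R.antipode_antipodeInv x]
  simp (disch := fun_prop) only [sw_comul_antipode, antipodeInv_antipode]
  rw [sw_mul_antipode _ hf, HopfAlgebra.counit_antipode]

theorem sw_mul_antipodeInv (x : H) {f : H → Z} (hf : IsLinearMap k f) :
    (sw (Δ x) fun a b => f (b * 𝑇 a)) = ε x • f 1 := by
  rw [← R.antipode_antipodeInv x]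
  simp (disch := fun_prop) only [sw_comul_antipode, antipodeInv_antipode]
  rw [sw_antipode_mul _ hf, HopfAlgebra.counit_antipode]

/-- The second slot of σ is antimultiplicative, so the convolution inverse arises from S⁻¹ through
S⁻¹(g₂)g₁ = ε(g), not from S. -/
theorem form_antipodeInv (h g : H) : σ h (𝑇 g) = τ h g := by
  rw [← R.sw_inv_form_cancel h g (f := fun h g => σ h (𝑇 g)) (by fun_prop) (by fun_prop)]
  calc _ = sw (Δ h) fun h₁ h₂ => sw (Δ g) fun g₁ g₂ => τ h₁ g₁ • sw (Δ g₂) fun g₂ g₃ =>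
        σ h₂ (𝑇 g₃ * g₂) := by
        refine sw_congr fun h₁ h₂ => sw_congr fun g₁ g₂ => ?_
        simp only [form_mul_right, smul_eq_mul, mul_sw]
        rw [sw_comm]
        simp only [mul_comm (σ _ (𝑇 _))]
    _ = sw (Δ h) fun h₁ h₂ => sw (Δ g) fun g₁ g₂ => ε h₂ • ε g₂ • τ h₁ g₁ := by
        refine sw_congr fun h₁ h₂ => sw_congr fun g₁ g₂ => ?_
        rw [R.sw_antipodeInv_mul g₂ (f := fun z => σ h₂ z) (by fun_prop), R.one_right]
        simp only [smul_eq_mul]; ring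
    _ = _ := by
        simp only [← smul_sw]
        simp (disch := fun_prop) only [sw_smul_counit]

theorem inv_antipode_right (h g : H) : τ h (𝑆 g) = σ h g := by
  rw [← form_antipodeInv, antipodeInv_antipode]

theorem form_antipode_antipode (h g : H) : σ (𝑆 h) (𝑆 g) = σ h g := by
  rw [form_antipode_left, inv_antipode_right]

/-- Applied twice, this removes S⁻² from the braiding of the Yetter–Drinfeld module. -/
theorem form_antipodeInv_antipodeInv (h g : H) : σ (𝑇 h) (𝑇 g) = σ h g := by
  rw [← form_antipode_antipode, antipode_antipodeInv, antipode_antipodeInv]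

theorem inv_mul_left (h h' g : H) :
    τ (h * h') g = sw (Δ g) fun g₁ g₂ => τ h g₂ * τ h' g₁ := by
  simp (disch := fun_prop) only [← form_antipodeInv, form_mul_left, sw_comul_antipodeInv]

theorem inv_mul_right (g h h' : H) :
    τ g (h * h') = sw (Δ g) fun g₁ g₂ => τ g₁ h * τ g₂ h' := by
  simp (disch := fun_prop) only [← form_antipode_left, form_mul_right, sw_comul_antipode]

theorem inv_one_left (h : H) : τ 1 h = ε h := by
  rw [← form_antipodeInv, R.one_left, counit_antipodeInv]

theorem inv_one_right (h : H) : τ h 1 = ε h := by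
  rw [← form_antipodeInv, antipodeInv_one, R.one_right]

end CQTStructure

/-! ### The right coadjoint coaction -/

variable (k) in
/-- The right coadjoint coaction `x ↦ x₂ ⊗ S(x₁) x₃`. -/
def coadjoint : H →ₗ[k] H ⊗[k] H :=
  IsLinearMap.mk' (fun x => sw (Δ x) fun a b => sw (Δ b) fun b c => b ⊗ₜ[k] (𝑆 a * c))
    (by fun_prop)

local notation "Ad" => coadjoint k

theorem sw_coadjoint (x : H) {f : H → H → Z} (h₁ : ∀ b, IsLinearMap k fun a => f a b)
    (h₂ : ∀ a, IsLinearMap k fun b => f a b) :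
    sw (Ad x) f = sw (Δ x) fun a b => sw (Δ b) fun b c => f b (𝑆 a * c) := by
  simp (disch := fun_prop) only [coadjoint, IsLinearMap.mk'_apply, sw_sw, sw_tmul]

theorem sw_coadjoint_assoc (x : H) {f : H → H → H → Z}
    (h₁ : ∀ b c, IsLinearMap k fun a => f a b c) (h₂ : ∀ a c, IsLinearMap k fun b => f a b c)
    (h₃ : ∀ a b, IsLinearMap k fun c => f a b c) :
    (sw (Ad x) fun a c => sw (Ad a) fun a b => f a b c) =
      sw (Ad x) fun a b => sw (Δ b) fun b c => f a b c := by
  simp (disch := fun_prop) only [sw_coadjoint, sw_comul_mul, sw_comul_antipode, sw_comul_assoc,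
    sw_comul_assoc_comm]

theorem sw_coadjoint_counit (x : H) {f : H → Z} (hf : IsLinearMap k f) :
    (sw (Ad x) fun a b => ε b • f a) = f x := by
  simp (disch := fun_prop) only [sw_coadjoint, Bialgebra.counit_mul, HopfAlgebra.counit_antipode,
    mul_smul]
  simp (disch := fun_prop) only [← smul_sw, sw_smul_counit, sw_counit_smul]

theorem sw_coadjoint_mul (x y : H) {f : H → H → Z} (h₁ : ∀ b, IsLinearMap k fun a => f a b)
    (h₂ : ∀ a, IsLinearMap k fun b => f a b) :
    sw (Ad (x * y)) f = sw (Ad x) fun a h => sw (Δ y) fun y₁ y₂ => sw (Δ y₂) fun y₂ y₃ =>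
      f (a * y₂) (𝑆 y₁ * h * y₃) := by
  simp (disch := fun_prop) only [sw_coadjoint, sw_comul_mul, HopfAlgebra.antipode_mul_antidistrib,
    mul_assoc]
  refine sw_congr fun a b => ?_
  rw [sw_comm]

/-- The inner legs p₃S(q₁) of the two coactions cancel. The product appears in the order g·h,
opposite to the tensor coaction of Yetter–Drinfeld modules; the twist in `bcomul` repairs this. -/
theorem sw_coadjoint_comul (x : H) {f : H → H → H → Z}
    (h₁ : ∀ b c, IsLinearMap k fun a => f a b c) (h₂ : ∀ a c, IsLinearMap k fun b => f a b c)
    (h₃ : ∀ a b, IsLinearMap k fun c => f a b c) :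
    (sw (Ad x) fun a c => sw (Δ a) fun a b => f a b c) =
      sw (Δ x) fun p q => sw (Ad p) fun a g => sw (Ad q) fun b h => f a b (g * h) := by
  symm
  calc _ = sw (Δ x) fun p₁ p₂ => sw (Δ p₂) fun p₂ p₃ => sw (Δ p₃) fun p₃ q₂ =>
        sw (Δ q₂) fun q₂ q₃ => sw (Δ p₃) fun p₃ q₁ => f p₂ q₂ (𝑆 p₁ * (p₃ * 𝑆 q₁) * q₃) := by
        simp (disch := fun_prop) only [sw_coadjoint, mul_assoc, sw_comul_assoc, sw_comul_assoc_comm]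
    _ = sw (Δ x) fun p₁ p₂ => sw (Δ p₂) fun p₂ p₃ => sw (Δ p₃) fun p₃ q₂ =>
        sw (Δ q₂) fun q₂ q₃ => ε p₃ • f p₂ q₂ (𝑆 p₁ * q₃) := by
        refine sw_congr fun p₁ _ => sw_congr fun p₂ _ => sw_congr fun p₃ _ => sw_congr fun q₂ q₃ => ?_
        rw [sw_mul_antipode p₃ (f := fun z => f p₂ q₂ (𝑆 p₁ * z * q₃)) (by fun_prop), mul_one]
    _ = _ := by
        simp only [← smul_sw]
        simp (disch := fun_prop) only [sw_counit_smul, sw_coadjoint, sw_comul_assoc]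

end CQT

/-! ### The braided multiplication -/

section CQT

variable {k H Z : Type*} [Field k] [Ring H] [HopfAlgebra k H] [AddCommGroup Z] [Module k Z]

local notation "Δ" => Coalgebra.comul (R := k)
local notation "ε" => Coalgebra.counit (R := k)
local notation "𝑆" => HopfAlgebra.antipode k
local notation "Ad" => coadjoint k

namespace CQTStructure

variable (R : CQTStructure k H)

local notation "σ" => CQTStructure.form R
local notation "τ" => CQTStructure.inv R
local notation "𝑇" => CQTStructure.antipodeInv R

/-- The right action `y ↦ σ⁻¹(h, y₂) y₁` of `H` on itself. -/
def regAct : H →ₗ[k] H →ₗ[k] H :=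
  mkBilin (fun h y => sw (Δ y) fun a b => τ h b • a) (by fun_prop) (by fun_prop)

local notation "α" => CQTStructure.regAct R

theorem regAct_apply (h y : H) : α h y = sw (Δ y) fun a b => τ h b • a := rfl

theorem regAct_mul (h x y : H) : α h (x * y) = sw (Δ h) fun h₁ h₂ => α h₁ x * α h₂ y := by
  simp (disch := fun_prop) only [regAct_apply, sw_comul_mul, inv_mul_right, sw_smul, sw_mul, mul_sw,
    smul_mul_smul_comm]
  rw [sw_comm]
  simp only [sw_comm (Δ h)]

theorem mul_regAct (h h' y : H) : α (h * h') y = α h' (α h y) := by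
  simp (disch := fun_prop) only [regAct_apply, inv_mul_left, sw_smul, lin_sw, map_smul, smul_sw,
    sw_comul_assoc, smul_smul]

theorem one_regAct (y : H) : α 1 y = y := by
  simp only [regAct_apply, inv_one_left]
  exact sw_smul_counit y (by fun_prop)

theorem regAct_one (h : H) : α h 1 = ε h • 1 := by
  simp (disch := fun_prop) only [regAct_apply, sw_comul_one, inv_one_right]

/-- The braided multiplication `x · y = σ⁻¹(S(x₁) x₃, y₂) x₂ y₁`. -/
def bmul : H →ₗ[k] H →ₗ[k] H :=
  mkBilin (fun x y => sw (Ad x) fun a h => a * α h y) (by fun_prop) (by fun_prop)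

local notation "μ" => CQTStructure.bmul R

theorem bmul_apply (x y : H) : μ x y = sw (Ad x) fun a h => a * α h y := rfl

/-- Colinearity of the product: the α-twist is chosen so that a single use of the τ-commutation rule
turns S(y₁)x₍₁₎y₃ into the order y₍₁₎x₍₁₎ required by the tensor coaction. -/
theorem sw_coadjoint_bmul (x y : H) {f : H → H → Z} (h₁ : ∀ b, IsLinearMap k fun a => f a b)
    (h₂ : ∀ a, IsLinearMap k fun b => f a b) :
    sw (Ad (μ x y)) f = sw (Ad x) fun x₀ x₁ => sw (Ad y) fun y₀ y₁ => f (μ x₀ y₀) (y₁ * x₁) := by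
  -- The bundled form of `f` lets sums and scalars be pulled out by the linear-map simp lemmas; the
  -- same device recurs below.
  let F := mkBilin f h₁ h₂
  change sw (Ad (μ x y)) (fun a b => F a b) =
    sw (Ad x) fun x₀ x₁ => sw (Ad y) fun y₀ y₁ => F (μ x₀ y₀) (y₁ * x₁)
  calc _ = sw (Ad x) fun a h => sw (Δ h) fun g h => sw (Δ y) fun p y => sw (Δ y) fun q y =>
        sw (Δ y) fun r s => τ h s • F (a * q) (𝑆 p * (g * r)) := by
        rw [← sw_coadjoint_assoc (k := k) x (f := fun a g h => sw (Δ y) fun p y =>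
          sw (Δ y) fun q y => sw (Δ y) fun r s => τ h s • F (a * q) (𝑆 p * (g * r)))
          (by fun_prop) (by fun_prop) (by fun_prop)]
        simp (disch := fun_prop) only [bmul_apply, regAct_apply, mul_sw, lin_sw, sw_sw,
          mul_smul_comm, map_smul, sw_smul_left, sw_coadjoint_mul, smul_sw]
        refine sw_congr fun a h => ?_
        conv_lhs => rw [sw_comm]
        simp (disch := fun_prop) only [sw_comul_assoc, mul_assoc]
    _ = sw (Ad x) fun a h => sw (Δ y) fun p y => sw (Δ y) fun q y => sw (Δ h) fun g h =>
        sw (Δ y) fun r s => τ h s • F (a * q) (𝑆 p * (g * r)) := by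
        refine sw_congr fun a h => ?_
        rw [sw_comm]
        refine sw_congr fun p y => ?_
        rw [sw_comm]
    _ = sw (Ad x) fun a h => sw (Δ y) fun p y => sw (Δ y) fun q y => sw (Δ h) fun g h =>
        sw (Δ y) fun r s => τ g r • F (a * q) (𝑆 p * (s * h)) := by
        refine sw_congr fun a h => sw_congr fun p y => sw_congr fun q y => ?_
        exact (R.sw_inv_comm h y (f := fun z => F (a * q) (𝑆 p * z)) (by fun_prop)).symm
    _ = _ := by
        simp (disch := fun_prop) only [bmul_apply, regAct_apply, mul_sw, lin_sw_apply,
          mul_smul_comm, map_smul, LinearMap.smul_apply]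
        symm
        calc _ = sw (Ad x) fun x₀ x₁ => sw (Ad x₀) fun a g => sw (Ad y) fun y₀ y₁ =>
              sw (Δ y₀) fun b c => τ g c • F (a * b) (y₁ * x₁) := sw_congr fun _ _ => sw_comm _ _ _
          _ = sw (Ad x) fun a h => sw (Δ h) fun g h => sw (Δ y) fun p y => sw (Δ y) fun q y =>
              sw (Δ y) fun r s => τ g r • F (a * q) (𝑆 p * (s * h)) := by
              simp (disch := fun_prop) only [sw_coadjoint_assoc, sw_coadjoint y, sw_comul_assoc,
                mul_assoc]
          _ = _ := by
              refine sw_congr fun a h => ?_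
              rw [sw_comm]
              refine sw_congr fun p y => ?_
              rw [sw_comm]

/-- By colinearity the left side is (x₍₀₎·y₍₀₎) α(y₍₁₎x₍₁₎, z), and α(y₍₁₎x₍₁₎, ·) is α(x₍₁₎,
α(y₍₁₎, ·)). The module-algebra law then gathers the two factors acted on by the legs of x₍₁₎. -/
theorem bmul_assoc (x y z : H) : μ (μ x y) z = μ x (μ y z) := by
  calc _ = sw (Ad x) fun x₀ x₁ => sw (Ad y) fun y₀ y₁ => μ x₀ y₀ * α x₁ (α y₁ z) := by
        rw [bmul_apply, sw_coadjoint_bmul _ _ _ (by fun_prop) (by fun_prop)]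
        simp only [mul_regAct]
    _ = sw (Ad x) fun x₀ x₁ => sw (Δ x₁) fun g h => sw (Ad y) fun y₀ y₁ =>
        x₀ * (α g y₀ * α h (α y₁ z)) := by
        rw [← sw_coadjoint_assoc (k := k) x (f := fun x₀ g h => sw (Ad y) fun y₀ y₁ =>
          x₀ * (α g y₀ * α h (α y₁ z))) (by fun_prop) (by fun_prop) (by fun_prop)]
        refine sw_congr fun x₀ x₁ => ?_
        rw [sw_comm]
        simp only [bmul_apply, sw_mul, mul_assoc]
    _ = _ := by
        simp only [bmul_apply, lin_sw, mul_sw, regAct_mul]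
        conv_rhs => rw [sw_comm]
        refine sw_congr fun x₀ x₁ => ?_
        rw [sw_comm]

theorem sw_coadjoint_one {f : H → H → Z} (h₁ : ∀ b, IsLinearMap k fun a => f a b)
    (h₂ : ∀ a, IsLinearMap k fun b => f a b) : sw (Ad (1 : H)) f = f 1 1 := by
  simp (disch := fun_prop) only [sw_coadjoint, sw_comul_one, HopfAlgebra.antipode_one, one_mul]

theorem one_bmul (y : H) : μ 1 y = y := by
  simp (disch := fun_prop) only [bmul_apply, sw_coadjoint_one, one_regAct, one_mul]

theorem bmul_one (x : H) : μ x 1 = x := by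
  simp only [bmul_apply, regAct_one, mul_smul_comm, mul_one]
  exact sw_coadjoint_counit x (by fun_prop)

theorem counit_regAct (h y : H) : ε (α h y) = τ h y := by
  simp only [regAct_apply, lin_sw, map_smul, smul_eq_mul, mul_comm (τ _ _)]
  exact sw_counit_smul y (f := fun z => τ h z) (by fun_prop)

/-- Applying ε removes the middle leg of the coadjoint coaction, leaving τ(S(x₁)x₂, y). -/
theorem counit_bmul (x y : H) : ε (μ x y) = ε x * ε y := by
  calc _ = sw (Ad x) fun a h => ε a • τ h y := by
        simp only [bmul_apply, lin_sw, Bialgebra.counit_mul, counit_regAct, smul_eq_mul]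
    _ = sw (Δ x) fun a b => τ (𝑆 a * b) y := by
        simp (disch := fun_prop) only [sw_coadjoint, sw_counit_smul]
    _ = _ := by
        rw [sw_antipode_mul x (f := fun z => τ z y) (by fun_prop), R.inv_one_left, smul_eq_mul]

/-! ### The coadjoint action and its exchange rules -/

/-- The action `h ⊗ x ↦ σ(h, S(x₁) x₃) x₂` induced by the right coadjoint coaction. -/
def coadjointAct : H →ₗ[k] H →ₗ[k] H :=
  mkBilin (fun h x => sw (Ad x) fun a g => σ h g • a) (by fun_prop) (by fun_prop)

local notation "θ" => CQTStructure.coadjointAct R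

theorem coadjointAct_apply (h x : H) : θ h x = sw (Ad x) fun a g => σ h g • a := rfl

theorem coadjointAct_mul (h h' x : H) : θ (h * h') x = θ h (θ h' x) := by
  simp (disch := fun_prop) only [coadjointAct_apply, form_mul_left, lin_sw, map_smul, sw_smul,
    smul_sw, sw_coadjoint_assoc, smul_smul, mul_comm]

theorem coadjointAct_one (x : H) : θ 1 x = x := by
  simp only [coadjointAct_apply, R.one_left]
  exact sw_coadjoint_counit x (by fun_prop)

/-- Colinearity of the product has legs y₍₁₎x₍₁₎; the antimultiplicative second slot of σ hands h₁
to x and h₂ to y. -/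
theorem coadjointAct_bmul (h x y : H) :
    θ h (μ x y) = sw (Δ h) fun h₁ h₂ => μ (θ h₁ x) (θ h₂ y) := by
  rw [coadjointAct_apply, sw_coadjoint_bmul _ _ _ (by fun_prop) (by fun_prop)]
  simp only [form_mul_right, coadjointAct_apply, lin_sw, sw_apply, map_smul,
    LinearMap.smul_apply, sw_smul, smul_sw, smul_smul]
  simp only [sw_comm (Δ h)]
  refine sw_comm _ _ _

/-- The functional-valued map `y ↦ σ(y₁, S(y₂) y₄) y₃`. -/
def selfAct : H →ₗ[k] H :=
  IsLinearMap.mk' (fun y => sw (Δ y) fun a b => θ a b) (by fun_prop)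

theorem selfAct_apply (y : H) : R.selfAct y = sw (Δ y) fun a b => θ a b := rfl

theorem sw_mul_coadjoint (y : H) {f : H → H → Z} (h₁ : ∀ b, IsLinearMap k fun a => f a b)
    (h₂ : ∀ a, IsLinearMap k fun b => f a b) :
    (sw (Δ y) fun y₁ y₂ => sw (Ad y₂) fun a h => f a (y₁ * h)) = sw (Δ y) f := by
  calc _ = sw (Δ y) fun p q => sw (Δ q) fun b c => sw (Δ p) fun p q => f b (p * 𝑆 q * c) := by
        simp (disch := fun_prop) only [sw_coadjoint, sw_comul_assoc_comm, mul_assoc]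
    _ = _ := by
        have (p b c : H) : (sw (Δ p) fun p q => f b (p * 𝑆 q * c)) = ε p • f b c := by
          rw [sw_mul_antipode p (f := fun z => f b (z * c)) (by fun_prop), one_mul]
        simp (disch := fun_prop) only [this, ← smul_sw, sw_counit_smul]

/-- On β(y) = θ(y₁, y₂) the coadjoint leg simplifies to y₃S⁻¹(y₁): commutation brings a leg of y
next to the coadjoint leg, where `sw_mul_coadjoint` absorbs its S-factor. -/
theorem sw_coadjoint_selfAct (y : H) {f : H → H → Z} (h₁ : ∀ b, IsLinearMap k fun a => f a b)
    (h₂ : ∀ a, IsLinearMap k fun b => f a b) :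
    sw (Ad (R.selfAct y)) f = sw (Δ y) fun y₁ y => sw (Δ y) fun y₂ y₃ =>
      f (R.selfAct y₂) (y₃ * 𝑇 y₁) := by
  let F := mkBilin f h₁ h₂
  change sw (Ad (R.selfAct y)) (fun a b => F a b) = sw (Δ y) fun y₁ y => sw (Δ y) fun y₂ y₃ =>
      F (R.selfAct y₂) (y₃ * 𝑇 y₁)
  -- The commutation axiom solved for one order: multiplying σ(g₂, h₂)h₁g₁ by an inverse leg S⁻¹ of
  -- g isolates σ(g, h₂)h₁.
  have comm (g h a : H) : (sw (Δ h) fun h₁ h₂ => σ g h₂ • F a h₁) =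
      sw (Δ g) fun g₁ g => sw (Δ g) fun g₂ g₃ => sw (Δ h) fun h₁ h₂ =>
        σ g₂ h₁ • F a (g₃ * h₂ * 𝑇 g₁) := by
    symm
    calc _ = sw (Δ g) fun g₁ g => sw (Δ g) fun g₂ g₃ => sw (Δ h) fun h₁ h₂ =>
          σ g₃ h₂ • F a (h₁ * g₂ * 𝑇 g₁) := by
          refine sw_congr fun g₁ g => ?_
          exact R.sw_form_comm g h (f := fun z => F a (z * 𝑇 g₁)) (by fun_prop)
      _ = sw (Δ g) fun g₁ g₃ => sw (Δ h) fun h₁ h₂ => sw (Δ g₁) fun g₁ g₂ =>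
          σ g₃ h₂ • F a (h₁ * (g₂ * 𝑇 g₁)) := by
          simp (disch := fun_prop) only [sw_comm (Δ h) (Δ _), sw_comul_assoc, mul_assoc]
      _ = _ := by
          have (p b c d : H) : (sw (Δ p) fun p q => σ c d • F a (b * (q * 𝑇 p))) =
              ε p • σ c d • F a b := by
            rw [R.sw_mul_antipodeInv p (f := fun z => σ c d • F a (b * z)) (by fun_prop), mul_one]
          simp (disch := fun_prop) only [this, ← smul_sw, sw_counit_smul]
  calc _ = sw (Δ y) fun g y => sw (Ad y) fun a h => sw (Δ h) fun h₁ h₂ => σ g h₂ • F a h₁ := by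
        simp (disch := fun_prop) only [selfAct_apply, coadjointAct_apply, lin_sw, map_smul, sw_sw,
          sw_smul_left, smul_sw, sw_coadjoint_assoc]
    _ = sw (Δ y) fun g y => sw (Ad y) fun a h => sw (Δ g) fun g₁ g => sw (Δ g) fun g₂ g₃ =>
        sw (Δ h) fun h₁ h₂ => σ g₂ h₁ • F a (g₃ * h₂ * 𝑇 g₁) := by
        simp only [comm]
    _ = sw (Δ y) fun g₁ y => sw (Δ y) fun g₂ y => sw (Δ y) fun g₃ y => sw (Ad y) fun a h =>
        sw (Ad a) fun a h₁ => σ g₂ h₁ • F a (g₃ * h * 𝑇 g₁) := by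
        simp (disch := fun_prop) only [sw_comm (Ad _) (Δ _), sw_coadjoint_assoc, sw_comul_assoc]
    _ = sw (Δ y) fun g₁ y => sw (Δ y) fun g₂ y => sw (Δ y) fun a h =>
        sw (Ad a) fun a h₁ => σ g₂ h₁ • F a (h * 𝑇 g₁) := by
        refine sw_congr fun g₁ y => sw_congr fun g₂ y => ?_
        exact sw_mul_coadjoint (k := k) y (f := fun a h => sw (Ad a) fun a h₁ =>
          σ g₂ h₁ • F a (h * 𝑇 g₁)) (by fun_prop) (by fun_prop)
    _ = _ := by
        simp (disch := fun_prop) only [selfAct_apply, coadjointAct_apply, lin_sw, map_smul,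
          sw_apply, LinearMap.smul_apply, sw_comul_assoc]

/-- The factor τ(a₂, y₂) = σ(a₂, S⁻¹(y₂)) merges with θ into σ(a, S⁻¹(y₄)y₃S⁻¹(y₁)), which collapses
to τ(a, y₁). -/
theorem sw_inv_coadjointAct_selfAct (a y : H) :
    (sw (Δ a) fun a₁ a₂ => sw (Δ y) fun y₁ y₂ => τ a₂ y₂ • θ a₁ (R.selfAct y₁)) =
      sw (Δ y) fun y₁ y₂ => τ a y₁ • R.selfAct y₂ := by
  calc _ = sw (Δ y) fun y₁ y₂ => sw (Ad (R.selfAct y₁)) fun z g => σ a (𝑇 y₂ * g) • z := by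
        rw [sw_comm]
        simp only [coadjointAct_apply, form_mul_right, sw_smul, form_antipodeInv, mul_smul, smul_sw]
        simp only [sw_comm (Δ a)]
    _ = sw (Δ y) fun y₁ y => sw (Δ y) fun y₂ y₃ => sw (Δ y₃) fun y₃ y₄ =>
        σ a (𝑇 y₄ * y₃ * 𝑇 y₁) • R.selfAct y₂ := by
        simp (disch := fun_prop) only [sw_coadjoint_selfAct, sw_comul_assoc, mul_assoc]
    _ = _ := by
        have (p b c : H) : (sw (Δ p) fun p q => σ a (𝑇 q * p * 𝑇 b) • c) =
            ε p • τ a b • c := by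
          rw [R.sw_antipodeInv_mul p (f := fun z => σ a (z * 𝑇 b) • c) (by fun_prop), one_mul,
            form_antipodeInv]
        simp (disch := fun_prop) only [this, sw_smul_counit]

end CQTStructure

end CQT

/-! ### The braided comultiplication -/

section CQT

variable {k H Z : Type*} [Field k] [Ring H] [HopfAlgebra k H] [AddCommGroup Z] [Module k Z]

local notation "Δ" => Coalgebra.comul (R := k)
local notation "ε" => Coalgebra.counit (R := k)
local notation "𝑆" => HopfAlgebra.antipode k
local notation "Ad" => coadjoint k

theorem sw_counit_coadjoint (x : H) {f : H → Z} (hf : IsLinearMap k f) :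
    (sw (Ad x) fun a h => ε a • f h) = ε x • f 1 := by
  simp (disch := fun_prop) only [sw_coadjoint, sw_counit_smul]
  exact sw_antipode_mul x hf

theorem sw_coadjoint_assoc₂ (x y : H) {f : H → H → H → H → H → H → Z}
    (h₁ : ∀ b c d e g, IsLinearMap k fun a => f a b c d e g)
    (h₂ : ∀ a c d e g, IsLinearMap k fun b => f a b c d e g)
    (h₃ : ∀ a b d e g, IsLinearMap k fun c => f a b c d e g)
    (h₄ : ∀ a b c e g, IsLinearMap k fun d => f a b c d e g)
    (h₅ : ∀ a b c d g, IsLinearMap k fun e => f a b c d e g)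
    (h₆ : ∀ a b c d e, IsLinearMap k fun g => f a b c d e g) :
    (sw (Ad x) fun a c => sw (Ad y) fun a' c' => sw (Ad a) fun a b => sw (Ad a') fun a' b' =>
        f a a' b b' c c') =
      sw (Ad x) fun a c => sw (Ad y) fun a' c' => sw (Δ c) fun b c => sw (Δ c') fun b' c' =>
        f a a' b b' c c' := by
  calc _ = sw (Ad x) fun a c => sw (Ad a) fun a b => sw (Ad y) fun a' c' => sw (Ad a') fun a' b' =>
        f a a' b b' c c' := sw_congr fun a c => sw_comm _ _ _
    _ = sw (Ad x) fun a c => sw (Δ c) fun b c => sw (Ad y) fun a' c' => sw (Δ c') fun b' c' =>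
        f a a' b b' c c' := by
        simp (disch := fun_prop) only [sw_coadjoint_assoc]
    _ = _ := sw_congr fun a c => sw_comm _ _ _

namespace CQTStructure

variable (R : CQTStructure k H)

local notation "σ" => CQTStructure.form R
local notation "τ" => CQTStructure.inv R
local notation "𝑇" => CQTStructure.antipodeInv R
local notation "α" => CQTStructure.regAct R
local notation "μ" => CQTStructure.bmul R
local notation "θ" => CQTStructure.coadjointAct R

/-- The braided comultiplication `x ↦ σ(a, b) p₀ ⊗ q₀`, where `x₁ ⊗ x₂ = p ⊗ q` has the
coadjoint coactions `p₀ ⊗ a` and `q₀ ⊗ b`. -/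
def bcomul : H →ₗ[k] H ⊗[k] H :=
  IsLinearMap.mk' (fun x => sw (Δ x) fun p q => sw (Ad p) fun p a => p ⊗ₜ[k] θ a q) (by fun_prop)

local notation "δ" => CQTStructure.bcomul R

theorem bcomul_apply (x : H) :
    δ x = sw (Δ x) fun p q => sw (Ad p) fun p a => p ⊗ₜ[k] θ a q := rfl

theorem sw_bcomul (x : H) {f : H → H → Z} (h₁ : ∀ b, IsLinearMap k fun a => f a b)
    (h₂ : ∀ a, IsLinearMap k fun b => f a b) :
    sw (δ x) f = sw (Δ x) fun p q => sw (Ad p) fun p a => f p (θ a q) := by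
  simp (disch := fun_prop) only [bcomul_apply, sw_sw, sw_tmul]

theorem sw_bcomul' (x : H) {f : H → H → Z} (h₁ : ∀ b, IsLinearMap k fun a => f a b)
    (h₂ : ∀ a, IsLinearMap k fun b => f a b) :
    sw (δ x) f = sw (Δ x) fun p q => sw (Ad p) fun p a => sw (Ad q) fun q b => σ a b • f p q := by
  let F := mkBilin f h₁ h₂
  change sw (δ x) (fun p q => F p q) = sw (Δ x) fun p q => sw (Ad p) fun p a =>
    sw (Ad q) fun q b => σ a b • F p q
  simp (disch := fun_prop) only [sw_bcomul, coadjointAct_apply, lin_sw, map_smul]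

/-- This is the 2-cocycle identity for σ: after commuting a₂b₂ past σ, both sides expand to the same
triple product of values of σ. -/
theorem form_yang_baxter (a b c : H) :
    (sw (Δ a) fun a₁ a₂ => sw (Δ b) fun b₁ b₂ => σ a₁ b₁ • σ (a₂ * b₂) c) =
      sw (Δ b) fun b₁ b₂ => sw (Δ c) fun c₁ c₂ => σ b₁ c₁ • σ a (b₂ * c₂) := by
  rw [R.sw_form_comm a b (f := fun z => σ z c) (by fun_prop), sw_comm]
  simp only [form_mul_left, form_mul_right, smul_eq_mul, mul_sw]
  refine sw_congr fun b₁ b₂ => ?_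
  rw [sw_comm]
  exact sw_congr fun c₁ c₂ => sw_congr fun a₁ a₂ => by ring

theorem counit_bcomul (x : H) {f : H → Z} (hf : IsLinearMap k f) :
    (sw (δ x) fun a b => ε a • f b) = f x := by
  simp (disch := fun_prop) only [sw_bcomul, sw_counit_coadjoint, coadjointAct_one, sw_counit_smul]

theorem counit_coadjointAct (h x : H) : ε (θ h x) = ε h * ε x := by
  have := sw_counit_coadjoint (k := k) x (f := fun z => σ h z) (by fun_prop)
  simp only [coadjointAct_apply, lin_sw, map_smul]
  simp only [R.one_right, smul_eq_mul, mul_comm] at this ⊢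
  exact this

theorem bcomul_counit (x : H) {f : H → Z} (hf : IsLinearMap k f) :
    (sw (δ x) fun a b => ε b • f a) = f x := by
  simp (disch := fun_prop) only [sw_bcomul, counit_coadjointAct, mul_smul]
  simp (disch := fun_prop) only [sw_coadjoint_counit, sw_smul_counit]

theorem sw_coadjoint_bcomul' (x : H) {f : H → H → H → Z}
    (h₁ : ∀ b c, IsLinearMap k fun a => f a b c) (h₂ : ∀ a c, IsLinearMap k fun b => f a b c)
    (h₃ : ∀ a b, IsLinearMap k fun c => f a b c) :
    (sw (Ad x) fun a h => sw (δ a) fun p q => f p q h) =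
      sw (Δ x) fun p q => sw (Ad p) fun p a => sw (Ad q) fun q b =>
        sw (Δ a) fun a a' => sw (Δ b) fun b b' => σ a b • f p q (a' * b') := by
  calc _ = sw (Δ x) fun p q => sw (Ad p) fun p a' => sw (Ad q) fun q b' => sw (Ad p) fun p a =>
        sw (Ad q) fun q b => σ a b • f p q (a' * b') := by
        simp (disch := fun_prop) only [sw_bcomul', sw_coadjoint_comul]
    _ = _ := by
        simp (disch := fun_prop) only [sw_coadjoint_assoc₂]

/-- Colinearity of the coproduct: the untwisted Δ produces the legs in the order ab, and the
twisting factor σ(a, b) reverses them to ba by the commutation axiom. -/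
theorem sw_coadjoint_bcomul (x : H) {f : H → H → H → Z}
    (h₁ : ∀ b c, IsLinearMap k fun a => f a b c) (h₂ : ∀ a c, IsLinearMap k fun b => f a b c)
    (h₃ : ∀ a b, IsLinearMap k fun c => f a b c) :
    (sw (Ad x) fun a h => sw (δ a) fun p q => f p q h) =
      sw (δ x) fun p q => sw (Ad p) fun p a => sw (Ad q) fun q b => f p q (b * a) := by
  calc _ = sw (Δ x) fun p q => sw (Ad p) fun p a => sw (Ad q) fun q b => sw (Δ a) fun a a' =>
        sw (Δ b) fun b b' => σ a' b' • f p q (b * a) := by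
        rw [R.sw_coadjoint_bcomul' x h₁ h₂ h₃]
        refine sw_congr fun p q => sw_congr fun p a => sw_congr fun q b => ?_
        exact R.sw_form_comm a b (f := fun z => f p q z) (by fun_prop)
    _ = sw (Δ x) fun p q => sw (Ad p) fun p a' => sw (Ad q) fun q b' => sw (Ad p) fun p a =>
        sw (Ad q) fun q b => σ a' b' • f p q (b * a) := by
        simp (disch := fun_prop) only [sw_coadjoint_assoc₂]
    _ = _ := by
        simp (disch := fun_prop) only [sw_bcomul', smul_sw]

/-- Both iterates are the double coproduct of x weighted by σ on three coadjoint legs; the two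
weights are the two sides of the cocycle identity. -/
theorem bcomul_coassoc (x : H) {f : H → H → H → Z}
    (h₁ : ∀ b c, IsLinearMap k fun a => f a b c) (h₂ : ∀ a c, IsLinearMap k fun b => f a b c)
    (h₃ : ∀ a b, IsLinearMap k fun c => f a b c) :
    (sw (δ x) fun a c => sw (δ a) fun a b => f a b c) =
      sw (δ x) fun a b => sw (δ b) fun b c => f a b c := by
  have ybe (c d b z : H) (w : Z) :
      (sw (Δ c) fun c₁ c₂ => sw (Δ d) fun d₁ d₂ => σ c₁ d₁ • σ (c₂ * d₂) b • w) =
        sw (Δ d) fun d₁ d₂ => sw (Δ b) fun b₁ b₂ => σ d₁ b₁ • σ c (d₂ * b₂) • w := by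
    have := congrArg (fun t => t • w) (R.form_yang_baxter c d b)
    simpa only [sw_smul, smul_assoc] using this
  calc _ = sw (Δ x) fun p q => sw (Ad q) fun q b => sw (Ad p) fun p a =>
        sw (δ p) fun r s => σ a b • f r s q := by
        simp (disch := fun_prop) only [sw_bcomul' _ x, smul_sw]
        exact sw_congr fun p q => sw_comm _ _ _
    _ = sw (Δ x) fun p q => sw (Ad q) fun q b => sw (Δ p) fun r s => sw (Ad r) fun r c =>
        sw (Ad s) fun s d => sw (Δ d) fun d₁ d₂ => sw (Δ b) fun b₁ b₂ =>
          σ d₁ b₁ • σ c (d₂ * b₂) • f r s q := by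
        refine sw_congr fun p q => sw_congr fun q b => ?_
        rw [R.sw_coadjoint_bcomul' p (f := fun r s a => σ a b • f r s q) (by fun_prop)
          (by fun_prop) (by fun_prop)]
        refine sw_congr fun r s => sw_congr fun r c => sw_congr fun s d => ?_
        exact ybe c d b q _
    _ = sw (Δ x) fun p q => sw (Δ p) fun r s => sw (Ad r) fun r c => sw (Ad s) fun s d =>
        sw (Ad q) fun q b => sw (Δ d) fun d₁ d₂ => sw (Δ b) fun b₁ b₂ =>
          σ d₁ b₁ • σ c (d₂ * b₂) • f r s q := by
        refine sw_congr fun p q => ?_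
        rw [sw_comm]
        refine sw_congr fun r s => ?_
        rw [sw_comm]
        refine sw_congr fun r c => ?_
        rw [sw_comm]
    _ = sw (Δ x) fun p q => sw (Ad p) fun p a => sw (Δ q) fun r s => sw (Ad r) fun r c =>
        sw (Ad s) fun s d => sw (Δ c) fun c₁ c₂ => sw (Δ d) fun d₁ d₂ =>
          σ c₁ d₁ • σ a (c₂ * d₂) • f p r s := by
        simp (disch := fun_prop) only [sw_comul_assoc]
        exact sw_congr fun p q => sw_comm _ _ _
    _ = sw (Δ x) fun p q => sw (Ad p) fun p a => sw (Ad q) fun q b => sw (δ q) fun r s =>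
        σ a b • f p r s := by
        refine sw_congr fun p q => sw_congr fun p a => ?_
        rw [R.sw_coadjoint_bcomul' q (f := fun r s b => σ a b • f p r s) (by fun_prop)
          (by fun_prop) (by fun_prop)]
    _ = _ := by
        simp (disch := fun_prop) only [sw_bcomul' _ x, smul_sw]

/-- The ordinary coproduct of a braided product, as a first step to its braided coproduct. Since α
acts through the last leg of y, only the right tensor factor sees it. -/
theorem sw_comul_bmul (x y : H) {f : H → H → Z} (h₁ : ∀ b, IsLinearMap k fun a => f a b)
    (h₂ : ∀ a, IsLinearMap k fun b => f a b) :
    sw (Δ (μ x y)) f = sw (Δ x) fun p q => sw (Ad p) fun p a => sw (Δ y) fun r s =>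
      f (p * r) (μ q (α a s)) := by
  let F := mkBilin f h₁ h₂
  change sw (Δ (μ x y)) (fun a b => F a b) = sw (Δ x) fun p q => sw (Ad p) fun p a =>
    sw (Δ y) fun r s => F (p * r) (μ q (α a s))
  calc _ = sw (Ad x) fun x h => sw (Δ x) fun p q => sw (Δ y) fun r s => F (p * r) (q * α h s) := by
        simp (disch := fun_prop) only [bmul_apply, regAct_apply, mul_sw, lin_sw, sw_sw, map_smul,
          mul_smul_comm, sw_smul_left, sw_comul_mul, smul_sw]
        refine sw_congr fun x h => ?_
        rw [sw_comm]
        refine sw_congr fun p q => ?_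
        simp (disch := fun_prop) only [sw_comul_assoc]
    _ = _ := by
        simp (disch := fun_prop) only [sw_coadjoint_comul, mul_regAct, bmul_apply, lin_sw]
        refine sw_congr fun p q => sw_congr fun p a => ?_
        rw [sw_comm]

/-- The exchange rule behind multiplicativity. Distributing θ over the product on the right side
gives τ(a₁, y₁) θ(y₂a₂, q)·β(y₃) with β(y) = θ(y₁, y₂). The τ-commutation rule reverses y₂a₂,
`sw_inv_coadjointAct_selfAct` transports τ past β, and θ is regrouped outside the product. -/
theorem sw_coadjointAct_bmul_regAct (a q y : H) :
    (sw (Δ a) fun a₁ a₂ => sw (Δ y) fun c s => θ (a₁ * c) (μ q (α a₂ s))) =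
      sw (Δ a) fun a₁ a₂ => sw (Δ y) fun t y => sw (Δ y) fun c s =>
        τ a₁ t • θ c (μ (θ a₂ q) s) := by
  symm
  calc _ = sw (Δ a) fun a₁ a₂ => sw (Δ y) fun t y => sw (Δ y) fun c y =>
        τ a₁ t • μ (θ (c * a₂) q) (R.selfAct y) := by
        simp (disch := fun_prop) only [coadjointAct_bmul, coadjointAct_mul, selfAct_apply, lin_sw,
          smul_sw, sw_comul_assoc]
    _ = sw (Δ y) fun y z => sw (Δ a) fun a₁ a₂ => sw (Δ y) fun t c =>
        τ a₁ t • μ (θ (c * a₂) q) (R.selfAct z) := by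
        simp (disch := fun_prop) only [sw_comm (Δ a) (Δ _), sw_comul_assoc]
    _ = sw (Δ y) fun y z => sw (Δ a) fun a₁ a₂ => sw (Δ y) fun t c =>
        τ a₂ c • μ (θ (a₁ * t) q) (R.selfAct z) := by
        refine sw_congr fun y z => ?_
        exact R.sw_inv_comm a y (f := fun w => μ (θ w q) (R.selfAct z)) (by fun_prop)
    _ = sw (Δ a) fun a₁ a₂ => sw (Δ y) fun t y => μ (θ (a₁ * t) q) (sw (Δ y) fun c z =>
        τ a₂ c • R.selfAct z) := by
        simp (disch := fun_prop) only [sw_comm (Δ a) (Δ _), sw_comul_assoc, lin_sw, map_smul]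
    _ = sw (Δ a) fun a₁ a₂ => sw (Δ y) fun t y => μ (θ (a₁ * t) q)
          (sw (Δ a₂) fun a₂ a₃ => sw (Δ y) fun z s => τ a₃ s • θ a₂ (R.selfAct z)) := by
        simp only [sw_inv_coadjointAct_selfAct]
    _ = sw (Δ y) fun t y => sw (Δ y) fun c y => sw (Δ y) fun z s => sw (Δ a) fun a₁ a₂ =>
        sw (Δ a₂) fun a₂ a₃ => τ a₃ s • μ (θ a₁ (θ t q)) (θ a₂ (θ c z)) := by
        simp (disch := fun_prop) only [coadjointAct_mul, selfAct_apply, lin_sw, smul_sw,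
          sw_comul_assoc, map_smul, sw_comm (Δ _) (Δ y)]
        refine sw_congr fun t y => ?_
        simp only [sw_comm (Δ _) (Δ y)]
        refine sw_congr fun c y => ?_
        simp only [sw_comm (Δ _) (Δ y)]
    _ = sw (Δ y) fun c y => sw (Δ y) fun z s => sw (Δ c) fun t c => sw (Δ a) fun a₁ a₃ =>
        sw (Δ a₁) fun a₁ a₂ => τ a₃ s • μ (θ a₁ (θ t q)) (θ a₂ (θ c z)) := by
        simp (disch := fun_prop) only [sw_comul_assoc, sw_comul_assoc_comm]
    _ = _ := by
        simp only [coadjointAct_mul]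
        simp (disch := fun_prop) only [coadjointAct_bmul, lin_sw, smul_sw, regAct_apply, map_smul]
        simp only [sw_comm (Δ _) (Δ y)]
        refine sw_congr fun c y => ?_
        simp only [sw_comm (Δ _) (Δ y)]
        refine sw_congr fun z s => ?_
        simp only [sw_comm (Δ _) (Δ c)]

/-- Multiplicativity of the braided comultiplication. -/
theorem bcomul_bmul (x y : H) :
    δ (μ x y) = sw (δ x) fun p q => sw (δ y) fun r s => sw (Ad r) fun r f =>
      μ p r ⊗ₜ[k] μ (θ f q) s := by
  symm
  calc _ = sw (Δ x) fun p q => sw (Ad p) fun p a => sw (Δ y) fun r s => sw (Ad r) fun r g =>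
        sw (Ad r) fun r f => μ p r ⊗ₜ[k] μ (θ f (θ a q)) (θ g s) := by
        simp (disch := fun_prop) only [sw_bcomul]
    -- The braiding contributes one coadjoint leg of r and the coproduct of y another; as θ acts by
    -- product automorphisms in the Hopf sense, they form a single action on the product.
    _ = sw (Δ x) fun p q => sw (Ad p) fun p a => sw (Δ y) fun r s => sw (Ad r) fun r f =>
        μ p r ⊗ₜ[k] θ f (μ (θ a q) s) := by
        simp (disch := fun_prop) only [sw_coadjoint_assoc, coadjointAct_bmul, tmul_sw]
    -- Unfolding μ(p, r) and the coadjoint leg S(y₁)y₄ isolates exactly the right side of the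
    -- exchange rule, with θ(S(b)) left outside.
    _ = sw (Δ x) fun p q => sw (Ad p) fun p a => sw (Ad p) fun p a' => sw (Δ y) fun b y =>
        sw (Δ y) fun u y => sw (Δ y) fun t y => sw (Δ y) fun c s =>
          τ a' t • (p * u) ⊗ₜ[k] θ (𝑆 b) (θ c (μ (θ a q) s)) := by
        refine sw_congr fun p q => sw_congr fun p a => ?_
        simp (disch := fun_prop) only [R.bmul_apply p, regAct_apply, mul_sw, sw_tmul_right,
          mul_smul_comm, ← TensorProduct.smul_tmul', sw_comm _ (Ad p)]
        refine sw_congr fun p a' => ?_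
        simp (disch := fun_prop) only [sw_coadjoint, sw_comul_assoc, coadjointAct_mul]
    _ = sw (Δ x) fun p q => sw (Ad p) fun p a => sw (Δ y) fun b y => sw (Δ y) fun u y =>
        (p * u) ⊗ₜ[k] θ (𝑆 b) (sw (Δ a) fun a a' => sw (Δ y) fun t y => sw (Δ y) fun c s =>
          τ a t • θ c (μ (θ a' q) s)) := by
        simp (disch := fun_prop) only [sw_coadjoint_assoc, lin_sw, map_smul, tmul_sw,
          TensorProduct.tmul_smul]
        refine sw_congr fun p q => sw_congr fun p a => ?_
        simp only [sw_comm (Δ _) (Δ a)]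
    _ = sw (Δ x) fun p q => sw (Ad p) fun p a => sw (Δ y) fun b y => sw (Δ y) fun u y =>
        (p * u) ⊗ₜ[k] θ (𝑆 b) (sw (Δ a) fun a a' => sw (Δ y) fun c s =>
          θ (a * c) (μ q (α a' s))) := by
        simp only [sw_coadjointAct_bmul_regAct]
    -- The legs S(b), a and c assemble to the coadjoint leg of the ordinary product p·r.
    _ = sw (Δ x) fun p q => sw (Ad p) fun p a => sw (Δ y) fun r s => sw (Ad (p * r)) fun z g =>
          z ⊗ₜ[k] θ g (μ q (α a s)) := by
        symm
        simp (disch := fun_prop) only [sw_coadjoint_mul, sw_comm (Δ y) (Ad _), sw_coadjoint_assoc,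
          lin_sw, tmul_sw]
        refine sw_congr fun p q => sw_congr fun p a => ?_
        simp (disch := fun_prop) only [sw_comm (Δ _) (Δ a), sw_comul_assoc, coadjointAct_mul]
    _ = _ := by
        rw [bcomul_apply, sw_comul_bmul _ _ _ (by fun_prop) (by fun_prop)]

end CQTStructure

end CQT

/-! ### The braided antipode -/

section CQT

variable {k H Z : Type*} [Field k] [Ring H] [HopfAlgebra k H] [AddCommGroup Z] [Module k Z]

local notation "Δ" => Coalgebra.comul (R := k)
local notation "ε" => Coalgebra.counit (R := k)
local notation "𝑆" => HopfAlgebra.antipode k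
local notation "Ad" => coadjoint k

theorem sw_coadjoint_antipode (x : H) {f : H → H → Z} (h₁ : ∀ b, IsLinearMap k fun a => f a b)
    (h₂ : ∀ a, IsLinearMap k fun b => f a b) :
    sw (Ad (𝑆 x)) f = sw (Δ x) fun a b => sw (Δ b) fun b c => f (𝑆 b) (𝑆 (𝑆 c) * 𝑆 a) := by
  simp (disch := fun_prop) only [sw_coadjoint, sw_comul_antipode, sw_comul_assoc]

namespace CQTStructure

variable (R : CQTStructure k H)

local notation "σ" => CQTStructure.form R
local notation "τ" => CQTStructure.inv R
local notation "𝑇" => CQTStructure.antipodeInv R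
local notation "α" => CQTStructure.regAct R
local notation "μ" => CQTStructure.bmul R
local notation "θ" => CQTStructure.coadjointAct R
local notation "δ" => CQTStructure.bcomul R

/-- The braided antipode `x ↦ σ⁻¹(x₁ S(x₃), x₄) S(x₂)`. -/
def bantipode : H →ₗ[k] H :=
  IsLinearMap.mk' (fun x => sw (Δ x) fun x₁ x => sw (Δ x) fun x₂ x => sw (Δ x) fun x₃ x₄ =>
    τ (x₁ * 𝑆 x₃) x₄ • 𝑆 x₂) (by fun_prop)

local notation "υ" => CQTStructure.bantipode R

theorem bantipode_apply (x : H) :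
    υ x = sw (Δ x) fun x₁ x => sw (Δ x) fun x₂ x => sw (Δ x) fun x₃ x₄ =>
      τ (x₁ * 𝑆 x₃) x₄ • 𝑆 x₂ := rfl

/-- Separates the value τ(S(x₃), x₄) as the functional u, so that u can later be moved across to
remove S². -/
theorem bantipode_eq (x : H) :
    υ x = sw (Δ x) fun x₁ x => sw (Δ x) fun x₂ x => sw (Δ x) fun x₃ x₄ =>
      R.drinfeld x₃ • τ x₁ x₄ • 𝑆 x₂ := by
  simp (disch := fun_prop) only [bantipode_apply, inv_mul_left, drinfeld_apply, sw_smul, mul_smul,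
    sw_comul_assoc]
  simp only [smul_comm (τ (𝑆 _) _)]

/-- The τ-commutation rule multiplied on the right by S(h₃), which cancels the leg of h next to it.
-/
theorem sw_inv_conj (h g : H) {f : H → Z} (hf : IsLinearMap k f) :
    (sw (Δ h) fun h₁ h => sw (Δ h) fun h₂ h₃ => sw (Δ g) fun g₁ g₂ =>
      τ h₂ g₂ • f (h₁ * g₁ * 𝑆 h₃)) = sw (Δ g) fun g₁ g₂ => τ h g₁ • f g₂ := by
  calc _ = sw (Δ h) fun h h₃ => sw (Δ h) fun h₁ h₂ => sw (Δ g) fun g₁ g₂ =>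
        τ h₂ g₂ • f (h₁ * g₁ * 𝑆 h₃) := by
        simp (disch := fun_prop) only [sw_comul_assoc]
    _ = sw (Δ h) fun h h₃ => sw (Δ h) fun h₁ h₂ => sw (Δ g) fun g₁ g₂ =>
        τ h₁ g₁ • f (g₂ * (h₂ * 𝑆 h₃)) := by
        refine sw_congr fun h h₃ => ?_
        rw [← R.sw_inv_comm h g (f := fun z => f (z * 𝑆 h₃)) (by fun_prop)]
        simp only [mul_assoc]
    _ = sw (Δ g) fun g₁ g₂ => sw (Δ h) fun h₁ h => sw (Δ h) fun h₂ h₃ =>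
        τ h₁ g₁ • f (g₂ * (h₂ * 𝑆 h₃)) := by
        simp (disch := fun_prop) only [sw_comul_assoc, sw_comm (Δ _) (Δ g)]
    _ = _ := by
        have (h a b g : H) : (sw (Δ h) fun h₂ h₃ => τ a b • f (g * (h₂ * 𝑆 h₃))) =
            ε h • τ a b • f g := by
          rw [sw_mul_antipode h (f := fun z => τ a b • f (g * z)) (by fun_prop), mul_one]
        simp (disch := fun_prop) only [this, sw_smul_counit]

/-- Conjugation by w₂S(z₁) brings in legs of w and z for which S(w₁)w₂ and S(z₃)g₁ cancel. The right
side is the coadjoint leg of the braided antipode; the left side is the leg needed for colinearity.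
-/
theorem sw_coadjoint_bantipode_aux (w z : H) {f : H → Z} (hf : IsLinearMap k f) :
    (sw (Δ w) fun w₁ w₂ => sw (Δ z) fun z₁ z => sw (Δ z) fun z₂ z₃ =>
      τ (w₂ * 𝑆 z₁) z₂ • f (𝑆 w₁ * z₃)) =
    sw (Δ w) fun w₁ w₂ => sw (Δ z) fun z₁ z => sw (Δ z) fun z₂ z₃ =>
      τ (w₁ * 𝑆 z₂) z₃ • f (𝑆 (𝑆 z₁) * 𝑆 w₂) := by
  have cancel₁ (w a b c d : H) : (sw (Δ w) fun w₁ w₂ => τ a b • f (𝑆 w₁ * w₂ * c * d)) =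
      ε w • τ a b • f (c * d) := by
    rw [sw_antipode_mul w (f := fun z => τ a b • f (z * c * d)) (by fun_prop), one_mul]
  have cancel₂ (z a b c : H) : (sw (Δ z) fun z₁ z₂ => τ a b • f (𝑆 z₁ * z₂ * c)) =
      ε z • τ a b • f c := by
    rw [sw_antipode_mul z (f := fun z => τ a b • f (z * c)) (by fun_prop), one_mul]
  calc _ = sw (Δ w) fun w₁ w₂ => sw (Δ z) fun z g => sw (Δ (w₂ * 𝑆 z)) fun h₁ h =>
        sw (Δ h) fun h₂ h₃ => sw (Δ g) fun g₁ g₂ => τ h₂ g₂ • f (𝑆 w₁ * (h₁ * g₁ * 𝑆 h₃)) := by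
        refine sw_congr fun w₁ w₂ => sw_congr fun z₁ z => ?_
        rw [R.sw_inv_conj (w₂ * 𝑆 z₁) z (f := fun z => f (𝑆 w₁ * z)) (by fun_prop)]
    _ = sw (Δ z) fun z g => sw (Δ z) fun z z₃ => sw (Δ z) fun z₁ z₂ => sw (Δ g) fun g₁ g₂ =>
        sw (Δ w) fun w₁ w => sw (Δ w) fun w₂ w => sw (Δ w) fun w₃ w₄ =>
          τ (w₃ * 𝑆 z₂) g₂ • f (𝑆 w₁ * w₂ * (𝑆 z₃ * g₁) * (𝑆 (𝑆 z₁) * 𝑆 w₄)) := by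
        simp (disch := fun_prop) only [sw_comul_mul, sw_comul_antipode,
          HopfAlgebra.antipode_mul_antidistrib, mul_assoc]
        simp only [sw_comm (Δ _) (Δ z)]
        refine sw_congr fun z g => ?_
        simp only [sw_comm (Δ _) (Δ z)]
        refine sw_congr fun z z₃ => ?_
        simp only [sw_comm (Δ _) (Δ z)]
        refine sw_congr fun z₁ z₂ => ?_
        simp only [sw_comm (Δ _) (Δ g)]
    _ = sw (Δ z) fun z₁ z => sw (Δ z) fun z₂ z => sw (Δ z) fun z g₂ => sw (Δ z) fun z₃ g₁ =>
        sw (Δ w) fun w w₃ => sw (Δ w₃) fun w₃ w₄ => sw (Δ w) fun w₁ w₂ =>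
          τ (w₃ * 𝑆 z₂) g₂ • f (𝑆 w₁ * w₂ * (𝑆 z₃ * g₁) * (𝑆 (𝑆 z₁) * 𝑆 w₄)) := by
        simp (disch := fun_prop) only [sw_comul_assoc, sw_comul_assoc_comm]
    _ = sw (Δ z) fun z₁ z => sw (Δ z) fun z₂ z => sw (Δ z) fun z g₂ => sw (Δ z) fun z₃ g₁ =>
        sw (Δ w) fun w₃ w₄ => τ (w₃ * 𝑆 z₂) g₂ • f (𝑆 z₃ * g₁ * (𝑆 (𝑆 z₁) * 𝑆 w₄)) := by
        simp (disch := fun_prop) only [cancel₁, ← smul_sw, sw_counit_smul]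
    _ = _ := by
        simp only [sw_comm (Δ _) (Δ w)]
        simp (disch := fun_prop) only [cancel₂, sw_counit_smul]

theorem sw_coadjoint_bantipode' (x : H) {f : H → H → Z} (h₁ : ∀ b, IsLinearMap k fun a => f a b)
    (h₂ : ∀ a, IsLinearMap k fun b => f a b) :
    sw (Ad (υ x)) f = sw (Δ x) fun w z => sw (Δ w) fun w c => sw (Δ w) fun w₁ w₂ =>
      sw (Δ z) fun z₁ z => sw (Δ z) fun z₂ z₃ =>
        τ (w₁ * 𝑆 z₂) z₃ • f (𝑆 c) (𝑆 (𝑆 z₁) * 𝑆 w₂) := by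
  simp (disch := fun_prop) only [bantipode_apply, lin_sw, map_smul, sw_sw, sw_smul_left,
    sw_coadjoint_antipode, smul_sw, sw_comul_assoc, sw_comul_assoc_comm]

theorem sw_coadjoint_bantipode (x : H) {f : H → H → Z} (h₁ : ∀ b, IsLinearMap k fun a => f a b)
    (h₂ : ∀ a, IsLinearMap k fun b => f a b) :
    sw (Ad (υ x)) f = sw (Ad x) fun a h => f (υ a) h := by
  let F := mkBilin f h₁ h₂
  change sw (Ad (υ x)) (fun a b => F a b) = sw (Ad x) fun a h => F (υ a) h
  rw [R.sw_coadjoint_bantipode' x (f := fun a b => F a b) (by fun_prop) (by fun_prop)]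
  calc _ = sw (Δ x) fun w z => sw (Δ w) fun w c => sw (Δ w) fun w₁ w₂ =>
      sw (Δ z) fun z₁ z => sw (Δ z) fun z₂ z₃ =>
        τ (w₂ * 𝑆 z₁) z₂ • F (𝑆 c) (𝑆 w₁ * z₃) := by
        refine sw_congr fun w z => sw_congr fun w c => ?_
        exact (R.sw_coadjoint_bantipode_aux w z (f := fun z => F (𝑆 c) z) (by fun_prop)).symm
    _ = _ := by
        simp (disch := fun_prop) only [bantipode_apply, lin_sw, sw_apply, map_smul,
          LinearMap.smul_apply, sw_coadjoint, sw_comul_assoc]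

theorem sw_regAct_coadjointAct (a q : H) :
    (sw (Δ a) fun a₁ a₂ => α a₁ (θ a₂ q)) = sw (Δ q) fun q₁ q₂ => σ a (𝑆 q₁) • q₂ := by
  calc _ = sw (Δ q) fun q₁ q => sw (Δ q) fun q q₄ => sw (Δ q) fun q₂ q₃ => sw (Δ a) fun a₁ a =>
        sw (Δ a) fun a₂ a₃ => τ a₁ q₃ • σ a₂ q₄ • σ a₃ (𝑆 q₁) • q₂ := by
        simp (disch := fun_prop) only [regAct_apply, coadjointAct_apply, sw_coadjoint, lin_sw,
          map_smul, form_mul_right, smul_sw, sw_smul, sw_comm (Δ _) (Δ q)]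
        refine sw_congr fun q₁ q => ?_
        simp only [sw_comm (Δ _) (Δ q)]
        refine sw_congr fun q q₄ => ?_
        simp only [sw_comm (Δ _) (Δ q)]
        refine sw_congr fun q₂ q₃ => sw_congr fun a₁ a => sw_congr fun a₂ a₃ => ?_
        simp only [smul_smul]
        congr 1
        ring
    _ = sw (Δ q) fun q₁ q => sw (Δ q) fun q₂ q => sw (Δ a) fun a a₃ => sw (Δ a) fun a₁ a₂ =>
        sw (Δ q) fun q₃ q₄ => τ a₁ q₃ • σ a₂ q₄ • σ a₃ (𝑆 q₁) • q₂ := by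
        simp (disch := fun_prop) only [sw_comul_assoc]
        refine sw_congr fun q₁ q => sw_congr fun q₂ q => ?_
        simp only [sw_comm (Δ _) (Δ q)]
    _ = _ := by
        simp (disch := fun_prop) only [sw_inv_form_smul, sw_counit_smul, sw_smul_counit]

/-- In α(a₁, θ(a₂, q)) the factor τ of α cancels half of the σ of θ, leaving σ(a, S(q₁))q₂. The
braided product after a coproduct is thus reduced to the product of H. -/
theorem bmul_coadjointAct (x q : H) :
    (sw (Ad x) fun x a => μ x (θ a q)) =
      sw (Ad x) fun x a => sw (Δ q) fun q₁ q₂ => σ a (𝑆 q₁) • (x * q₂) := by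
  calc _ = sw (Ad x) fun x a => x * sw (Δ a) fun a₁ a₂ => α a₁ (θ a₂ q) := by
        simp (disch := fun_prop) only [bmul_apply, sw_coadjoint_assoc, mul_sw]
    _ = _ := by
        simp only [sw_regAct_coadjointAct, mul_sw, mul_smul_comm]

/-- Colinearity of the antipode puts the sum in the form treated by `bmul_coadjointAct`. The weights
then cancel in two pairs and S(c)q remains. -/
theorem bantipode_left (x : H) : (sw (δ x) fun p q => μ (υ p) q) = ε x • 1 := by
  have cancel (z g : H) (c : H) : (sw (Δ z) fun z₁ z₂ => sw (Δ g) fun g₁ g₂ =>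
      τ z₁ g₂ • τ (𝑆 z₂) g₁ • c) = ε z • ε g • c := by
    have := sw_mul_antipode (k := k) z (f := fun z => τ z g • c) (by fun_prop)
    simpa only [inv_mul_left, inv_one_left, sw_smul, mul_smul] using this
  calc _ = sw (Δ x) fun p q => sw (Ad (υ p)) fun P a => sw (Δ q) fun q₁ q₂ =>
        σ a (𝑆 q₁) • (P * q₂) := by
        simp (disch := fun_prop) only [sw_bcomul]
        refine sw_congr fun p q => ?_
        rw [← R.bmul_coadjointAct, R.sw_coadjoint_bantipode p (f := fun P a => μ P (θ a q))
          (by fun_prop) (by fun_prop)]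
    _ = sw (Δ x) fun w₁ x => sw (Δ x) fun w₂ x => sw (Δ x) fun c x => sw (Δ x) fun z₁ x =>
        sw (Δ x) fun z₂ x => sw (Δ x) fun z q => sw (Δ z) fun z₃ z₄ => sw (Δ q) fun q₁ q =>
        sw (Δ q) fun q₂ q₃ =>
          τ w₁ z₄ • σ w₂ q₁ • τ z₁ q₂ • τ (𝑆 z₂) z₃ • (𝑆 c * q₃) := by
        conv_lhs =>
          simp (disch := fun_prop) only [sw_coadjoint_bantipode', form_mul_left, sw_comul_antipode,
            form_antipode_left, inv_antipode_right, inv_mul_left, sw_smul, smul_sw, mul_smul,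
            sw_comul_assoc]
        refine sw_congr fun w₁ x => sw_congr fun w₂ x => sw_congr fun c x => sw_congr fun z₁ x =>
          sw_congr fun z₂ x => sw_congr fun z q => ?_
        simp only [sw_comm (Δ _) (Δ z)]
        refine sw_congr fun z₃ z₄ => sw_congr fun q₁ q => sw_congr fun q₂ q₃ => ?_
        simp only [smul_smul]
        congr 1
        ring
    -- The legs are regrouped so that τ(w₁, z₄)σ(w₂, q₁) is a convolution product over Δ(w) and
    -- Δ(z).
    _ = sw (Δ x) fun w x => sw (Δ w) fun w₁ w₂ => sw (Δ x) fun c x => sw (Δ x) fun z₁ x =>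
        sw (Δ x) fun z₂ x => sw (Δ x) fun z₃ x => sw (Δ x) fun z x => sw (Δ z) fun z₄ q₁ =>
        sw (Δ x) fun q₂ q₃ =>
          τ w₁ z₄ • σ w₂ q₁ • τ z₁ q₂ • τ (𝑆 z₂) z₃ • (𝑆 c * q₃) := by
        simp (disch := fun_prop) only [sw_comul_assoc]
    _ = sw (Δ x) fun w x => sw (Δ x) fun c x => sw (Δ x) fun z₁ x => sw (Δ x) fun z₂ x =>
        sw (Δ x) fun z₃ x => sw (Δ x) fun z x => sw (Δ x) fun q₂ q₃ => sw (Δ w) fun w₁ w₂ =>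
        sw (Δ z) fun z₄ q₁ => τ w₁ z₄ • σ w₂ q₁ • τ z₁ q₂ • τ (𝑆 z₂) z₃ • (𝑆 c * q₃) := by
        refine sw_congr fun w x => ?_
        simp only [sw_comm (Δ w)]
        refine sw_congr fun c x => sw_congr fun z₁ x => sw_congr fun z₂ x => sw_congr fun z₃ x =>
          sw_congr fun z x => ?_
        simp only [sw_comm (Δ z)]
    _ = sw (Δ x) fun c x => sw (Δ x) fun z x => sw (Δ x) fun g q => sw (Δ z) fun z₁ z₂ =>
        sw (Δ g) fun g₁ g₂ => τ z₁ g₂ • τ (𝑆 z₂) g₁ • (𝑆 c * q) := by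
        simp only [sw_inv_form_smul]
        simp (disch := fun_prop) only [sw_counit_smul, ← smul_sw]
        refine sw_congr fun c x => ?_
        calc _ = sw (Δ x) fun z x => sw (Δ z) fun z₁ z₂ => sw (Δ x) fun g q => sw (Δ g) fun g₁ g₂ =>
              τ z₁ g₂ • τ (𝑆 z₂) g₁ • (𝑆 c * q) := by
              simp (disch := fun_prop) only [sw_comul_assoc]
          _ = _ := sw_congr fun z x => sw_comm _ _ _
    _ = _ := by
        simp (disch := fun_prop) only [cancel, ← smul_sw, sw_counit_smul]
        exact sw_antipode_mul x IsLinearMap.fun_id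

theorem coadjointAct_bantipode (h x : H) : θ h (υ x) = υ (θ h x) := by
  rw [coadjointAct_apply, R.sw_coadjoint_bantipode x (by fun_prop) (by fun_prop),
    coadjointAct_apply]
  simp only [lin_sw, map_smul]

/-- Comultiplying S(q₂) and applying S produces S²; moving u from one side of that leg to the other
removes it. -/
theorem sw_comul_bantipode (a q p : H) :
    (sw (Δ (υ q)) fun q₁ q₂ => σ a (𝑆 q₁) • (p * q₂)) =
      sw (Δ q) fun q₁ q => sw (Δ q) fun q₂ q => sw (Δ q) fun q₃ q => sw (Δ q) fun q₄ q₅ =>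
        R.drinfeld q₃ • σ a q₄ • τ q₁ q₅ • (p * 𝑆 q₂) := by
  calc _ = sw (Δ q) fun q₁ q => sw (Δ q) fun q₂ q => sw (Δ q) fun c q₅ => sw (Δ c) fun q₃ q₄ =>
        R.drinfeld q₄ • σ a (𝑆 (𝑆 q₃)) • τ q₁ q₅ • (p * 𝑆 q₂) := by
        simp (disch := fun_prop) only [bantipode_eq, lin_sw, map_smul, sw_sw, sw_smul_left,
          sw_comul_antipode, smul_sw]
        refine sw_congr fun q₁ q => ?_
        calc _ = sw (Δ q) fun b q => sw (Δ b) fun q₂ q₃ => sw (Δ q) fun q₄ q₅ =>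
              R.drinfeld q₄ • σ a (𝑆 (𝑆 q₃)) • τ q₁ q₅ • (p * 𝑆 q₂) := by
              refine sw_congr fun b q => ?_
              simp only [sw_comm (Δ _) (Δ b), smul_comm (τ _ _)]
          _ = _ := by
              simp (disch := fun_prop) only [sw_comul_assoc]
    _ = sw (Δ q) fun q₁ q => sw (Δ q) fun q₂ q => sw (Δ q) fun c q₅ => sw (Δ c) fun q₃ q₄ =>
        R.drinfeld q₃ • σ a q₄ • τ q₁ q₅ • (p * 𝑆 q₂) := by
        refine sw_congr fun q₁ q => sw_congr fun q₂ q => sw_congr fun c q₅ => ?_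
        exact R.sw_drinfeld_smul c (f := fun z => σ a z • τ q₁ q₅ • (p * 𝑆 q₂)) (by fun_prop)
    _ = _ := by
        simp (disch := fun_prop) only [sw_comul_assoc]

/-- Since υ commutes with θ, `bmul_coadjointAct` applies to υ(q). Then σ(p₃, q₅)τ(q₁, q₆) cancels,
next p₂S(q₂), and finally u against the remaining τ. -/
theorem bantipode_right (x : H) : (sw (δ x) fun p q => μ p (υ q)) = ε x • 1 := by
  have cancel₁ (p g : H) (c : H) : (sw (Δ p) fun p₁ p₂ => sw (Δ g) fun g₁ g₂ =>
      τ p₁ g₂ • τ (𝑆 p₂) g₁ • c) = ε p • ε g • c := by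
    have := sw_mul_antipode (k := k) p (f := fun z => τ z g • c) (by fun_prop)
    simpa only [inv_mul_left, inv_one_left, sw_smul, mul_smul] using this
  have cancel₂ (y : H) (c d : k) : (sw (Δ y) fun a b => c • d • (a * 𝑆 b)) =
      ε y • c • d • (1 : H) :=
    sw_mul_antipode (k := k) y (f := fun z => c • d • z) (by fun_prop)
  calc _ = sw (Δ x) fun p q => sw (Ad p) fun p a => sw (Δ (υ q)) fun q₁ q₂ =>
        σ a (𝑆 q₁) • (p * q₂) := by
        simp (disch := fun_prop) only [sw_bcomul, ← coadjointAct_bantipode, bmul_coadjointAct]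
    _ = sw (Δ x) fun p₁ x => sw (Δ x) fun p₂ x => sw (Δ x) fun y x => sw (Δ y) fun p₃ q₁ =>
        sw (Δ x) fun q₂ x => sw (Δ x) fun q₃ x => sw (Δ x) fun q₄ x => sw (Δ x) fun q₅ q₆ =>
          σ p₃ q₅ • τ q₁ q₆ • τ p₁ q₄ • R.drinfeld q₃ • (p₂ * 𝑆 q₂) := by
        simp (disch := fun_prop) only [sw_comul_bantipode]
        simp (disch := fun_prop) only [sw_coadjoint, form_mul_left, form_antipode_left, smul_sw,
          sw_smul, mul_smul, sw_comul_assoc]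
        refine sw_congr fun p₁ x => sw_congr fun p₂ x => sw_congr fun p₃ x => sw_congr fun q₁ x =>
          sw_congr fun q₂ x => sw_congr fun q₃ x => sw_congr fun q₄ x => sw_congr fun q₅ q₆ => ?_
        simp only [smul_smul]
        congr 1
        ring
    _ = sw (Δ x) fun p₁ x => sw (Δ x) fun p₂ x => sw (Δ x) fun y x => sw (Δ x) fun q₂ x =>
        sw (Δ x) fun q₃ x => sw (Δ x) fun q₄ z => sw (Δ y) fun p₃ q₁ => sw (Δ z) fun q₅ q₆ =>
          σ p₃ q₅ • τ q₁ q₆ • τ p₁ q₄ • R.drinfeld q₃ • (p₂ * 𝑆 q₂) := by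
        refine sw_congr fun p₁ x => sw_congr fun p₂ x => sw_congr fun y x => ?_
        simp only [sw_comm (Δ y)]
    _ = sw (Δ x) fun p₁ x => sw (Δ x) fun y x => sw (Δ x) fun q₃ q₄ => sw (Δ y) fun p₂ q₂ =>
          τ p₁ q₄ • R.drinfeld q₃ • (p₂ * 𝑆 q₂) := by
        simp only [sw_form_inv_smul]
        simp (disch := fun_prop) only [sw_counit_smul, sw_smul_counit, ← smul_sw]
        refine sw_congr fun p₁ x => ?_
        calc _ = sw (Δ x) fun y x => sw (Δ y) fun p₂ q₂ => sw (Δ x) fun q₃ q₄ =>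
              τ p₁ q₄ • R.drinfeld q₃ • (p₂ * 𝑆 q₂) := by
              simp (disch := fun_prop) only [sw_comul_assoc]
          _ = _ := by
              simp only [smul_sw]
              exact sw_congr fun y x => sw_comm _ _ _
    _ = sw (Δ x) fun p g => sw (Δ p) fun p₁ p₂ => sw (Δ g) fun g₁ g₂ =>
          τ p₁ g₂ • τ (𝑆 p₂) g₁ • 1 := by
        simp only [cancel₂]
        simp (disch := fun_prop) only [sw_counit_smul, ← smul_sw]
        simp (disch := fun_prop) only [drinfeld_apply, sw_smul, smul_sw, sw_comul_assoc]
    _ = _ := by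
        simp only [cancel₁]
        exact sw_counit_smul x (f := fun g => ε g • 1) (by fun_prop)

end CQTStructure

end CQT

/-! ### Tensor-product maps as Sweedler sums -/

section Sweedler

variable {k U V W Z Y : Type*} [CommSemiring k] [AddCommMonoid U] [Module k U] [AddCommMonoid V]
  [Module k V] [AddCommMonoid W] [Module k W] [AddCommMonoid Z] [Module k Z] [AddCommMonoid Y]
  [Module k Y]

theorem lift_eq_sw (g : V →ₗ[k] W →ₗ[k] Z) (t : V ⊗[k] W) :
    TensorProduct.lift g t = sw t fun v w => g v w := by
  conv_lhs => rw [← sw_tmul_eq_self t]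
  simp only [lin_sw, TensorProduct.lift.tmul]

theorem map_eq_sw (g : V →ₗ[k] Z) (h : W →ₗ[k] Y) (t : V ⊗[k] W) :
    TensorProduct.map g h t = sw t fun v w => g v ⊗ₜ[k] h w := by
  conv_lhs => rw [← sw_tmul_eq_self t]
  simp only [lin_sw, TensorProduct.map_tmul]

theorem rTensor_eq_sw (g : V →ₗ[k] Z) (t : V ⊗[k] W) :
    g.rTensor W t = sw t fun v w => g v ⊗ₜ[k] w := map_eq_sw _ _ _

theorem lTensor_eq_sw (g : W →ₗ[k] Z) (t : V ⊗[k] W) :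
    g.lTensor V t = sw t fun v w => v ⊗ₜ[k] g w := map_eq_sw _ _ _

theorem assoc_rTensor_eq_sw (g : V →ₗ[k] Z ⊗[k] Y) (t : V ⊗[k] W) :
    TensorProduct.assoc k Z Y W (g.rTensor W t) =
      sw t fun v w => sw (g v) fun z y => z ⊗ₜ[k] (y ⊗ₜ[k] w) := by
  rw [rTensor_eq_sw, map_sw (g := TensorProduct.assoc k Z Y W) (LinearEquiv.toLinearMap _).isLinear]
  refine sw_congr fun v w => ?_
  conv_lhs => rw [← sw_tmul_eq_self (g v)]
  rw [sw_tmul_right, map_sw (g := TensorProduct.assoc k Z Y W) (LinearEquiv.toLinearMap _).isLinear]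
  rfl

theorem lTensor_eq_sw_sw (g : W →ₗ[k] Z ⊗[k] Y) (t : V ⊗[k] W) :
    g.lTensor V t = sw t fun v w => sw (g w) fun z y => v ⊗ₜ[k] (z ⊗ₜ[k] y) := by
  simp only [lTensor_eq_sw, ← tmul_sw, sw_tmul_eq_self]

theorem rid_lTensor_eq_sw (g : W →ₗ[k] k) (t : V ⊗[k] W) :
    TensorProduct.rid k V (g.lTensor V t) = sw t fun v w => g w • v := by
  rw [lTensor_eq_sw, map_sw (g := TensorProduct.rid k V) (LinearEquiv.toLinearMap _).isLinear]
  simp only [TensorProduct.rid_tmul]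

theorem lid_rTensor_eq_sw (g : V →ₗ[k] k) (t : V ⊗[k] W) :
    TensorProduct.lid k W (g.rTensor W t) = sw t fun v w => g v • w := by
  rw [rTensor_eq_sw, map_sw (g := TensorProduct.lid k W) (LinearEquiv.toLinearMap _).isLinear]
  simp only [TensorProduct.lid_tmul]

end Sweedler

/-! ### Yetter–Drinfeld modules induced by the form -/

section YetterDrinfeld

variable {k H M N Z : Type*} [Field k] [Ring H] [HopfAlgebra k H] [AddCommGroup M] [Module k M]
  [AddCommGroup N] [Module k N] [AddCommGroup Z] [Module k Z]

local notation "Δ" => Coalgebra.comul (R := k)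
local notation "ε" => Coalgebra.counit (R := k)
local notation "𝑆" => HopfAlgebra.antipode k
local notation "Ad" => coadjoint k

theorem IsSweedler₂.sum_eq_sw {h : H} {n : ℕ} {h₁ h₂ : Fin n → H} (hh : IsSweedler₂ k h h₁ h₂)
    {f : H → H → Z} (hf₁ : ∀ b, IsLinearMap k fun a => f a b)
    (hf₂ : ∀ a, IsLinearMap k fun b => f a b) : ∑ i, f (h₁ i) (h₂ i) = sw (Δ h) f := by
  rw [hh, sw_sum _ _ _ hf₁ hf₂]

namespace CQTStructure

variable (R : CQTStructure k H)

local notation "σ" => CQTStructure.form R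
local notation "𝑇" => CQTStructure.antipodeInv R
local notation "μ" => CQTStructure.bmul R
local notation "θ" => CQTStructure.coadjointAct R
local notation "δ" => CQTStructure.bcomul R
local notation "υ" => CQTStructure.bantipode R

/-- A right comodule over a coquasitriangular Hopf algebra is a left-right Yetter–Drinfeld module
with the action `h • m = σ(h, m₍₁₎) m₍₀₎`. -/
def yetterDrinfeld (ρ : M →ₗ[k] M ⊗[k] H)
    (coassoc : (TensorProduct.assoc k M H H).toLinearMap ∘ₗ ρ.rTensor H ∘ₗ ρ =
      (Coalgebra.comul (R := k) (A := H)).lTensor M ∘ₗ ρ)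
    (counit : (TensorProduct.rid k M).toLinearMap ∘ₗ
      (Coalgebra.counit (R := k) (A := H)).lTensor M ∘ₗ ρ = LinearMap.id) :
    LeftRightYD k H M where
  act := mkBilin (fun h m => sw (ρ m) fun m₀ m₁ => σ h m₁ • m₀) (by fun_prop) (by fun_prop)
  coact := ρ
  act_one := by
    ext m
    change (sw (ρ m) fun m₀ m₁ => σ 1 m₁ • m₀) = m
    simp only [R.one_left, ← rid_lTensor_eq_sw]
    exact LinearMap.congr_fun counit m
  act_mul h g := by
    ext m
    change (sw (ρ m) fun m₀ m₁ => σ (h * g) m₁ • m₀) =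
      sw (ρ (sw (ρ m) fun m₀ m₁ => σ g m₁ • m₀)) fun m₀ m₁ => σ h m₁ • m₀
    simp (disch := fun_prop) only [lin_sw, map_smul, sw_sw, sw_smul_left, smul_sw, form_mul_left,
      sw_smul, mul_smul]
    simp only [smul_comm (σ g _)]
    exact (sw_assoc (LinearMap.congr_fun coassoc m) (f := fun m a b => σ h a • σ g b • m)
      (by fun_prop) (by fun_prop) (by fun_prop)).symm
  coact_coassoc := coassoc
  coact_counit := counit
  compat h n h₁ h₂ hh m := by
    have assoc {f : M → H → H → M ⊗[k] H} (hf₁ : ∀ b c, IsLinearMap k fun a => f a b c)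
        (hf₂ : ∀ a c, IsLinearMap k fun b => f a b c)
        (hf₃ : ∀ a b, IsLinearMap k fun c => f a b c) :
        (sw (ρ m) fun a c => sw (ρ a) fun a b => f a b c) =
          sw (ρ m) fun a b => sw (Δ b) fun b c => f a b c :=
      sw_assoc (LinearMap.congr_fun coassoc m) hf₁ hf₂ hf₃
    simp only [map_eq_sw, lTensor_eq_sw]
    refine (hh.sum_eq_sw (f := fun h₁ h₂ => sw (ρ m) fun m₀ m₁ =>
      (sw (ρ m₀) fun m₀ m₁ => σ h₁ m₁ • m₀) ⊗ₜ[k] (h₂ * m₁)) (by fun_prop) (by fun_prop)).trans ?_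
    refine .trans ?_ (hh.sum_eq_sw (f := fun h₁ h₂ => sw (ρ (sw (ρ m) fun m₀ m₁ => σ h₂ m₁ • m₀))
      fun m₀ m₁ => m₀ ⊗ₜ[k] (m₁ * h₁)) (by fun_prop) (by fun_prop)).symm
    simp (disch := fun_prop) only [lin_sw, map_smul, sw_sw, sw_smul_left, smul_sw, sw_tmul_right,
      assoc, ← TensorProduct.smul_tmul']
    rw [sw_comm]
    conv_rhs => rw [sw_comm]
    refine sw_congr fun a g => ?_
    -- The Yetter–Drinfeld condition is the commutation axiom for h and the coaction leg g.
    exact R.sw_form_comm h g (f := fun z => a ⊗ₜ[k] z) (by fun_prop)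

/-- The action of a Yetter–Drinfeld module is the one induced by its coaction and `σ`. -/
def IsInduced (X : LeftRightYD k H M) : Prop :=
  ∀ h m, X.act h m = sw (X.coact m) fun m₀ m₁ => σ h m₁ • m₀

variable {R}

/-- Both actions are computed from the coactions by the same formula, so a colinear map respects
them. -/
theorem IsInduced.isHom {X : LeftRightYD k H M} {Y : LeftRightYD k H N} (hX : IsInduced R X)
    (hY : IsInduced R Y) {f : M →ₗ[k] N} (hf : f.rTensor H ∘ₗ X.coact = Y.coact ∘ₗ f) :
    X.IsHom Y f := by
  refine ⟨fun h => LinearMap.ext fun m => ?_, hf⟩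
  have hm : f.rTensor H (X.coact m) = Y.coact (f m) := LinearMap.congr_fun hf m
  simp (disch := fun_prop) only [LinearMap.comp_apply, hX h m, hY h (f m), ← hm, rTensor_eq_sw,
    sw_sw, sw_tmul, lin_sw, map_smul]

theorem sw_tensorCoact (X : LeftRightYD k H M) (Y : LeftRightYD k H N) (m : M) (n : N)
    {f : M ⊗[k] N → H → Z} (h₁ : ∀ b, IsLinearMap k fun a => f a b)
    (h₂ : ∀ a, IsLinearMap k fun b => f a b) :
    sw (LeftRightYD.tensorCoact X Y (m ⊗ₜ n)) f = sw (X.coact m) fun m₀ m₁ =>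
      sw (Y.coact n) fun n₀ n₁ => f (m₀ ⊗ₜ n₀) (n₁ * m₁) := by
  rw [LeftRightYD.tensorCoact_tmul]
  conv_lhs => rw [← sw_tmul_eq_self (X.coact m), ← sw_tmul_eq_self (Y.coact n)]
  simp (disch := fun_prop) only [sw_tmul_right, tmul_sw, lin_sw, LeftRightYD.mergeCoact_tmul, sw_sw,
    sw_tmul]
  exact sw_comm _ _ _

/-- The reversed order n₍₁₎m₍₁₎ in the tensor coaction matches the reversed order in the second slot
of σ. -/
theorem IsInduced.tensor {X : LeftRightYD k H M} {Y : LeftRightYD k H N} (hX : IsInduced R X)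
    (hY : IsInduced R Y) : IsInduced R (X.tensor Y) := by
  intro h z
  have hz : IsLinearMap k fun z : M ⊗[k] N => sw ((X.tensor Y).coact z) fun m₀ m₁ => σ h m₁ • m₀ := by
    fun_prop
  change _ = hz.mk' _ z
  refine LinearMap.congr_fun (TensorProduct.ext' fun m n => ?_) z
  change LeftRightYD.tensorAct X Y h (m ⊗ₜ n) =
    sw (LeftRightYD.tensorCoact X Y (m ⊗ₜ n)) fun m₀ m₁ => σ h m₁ • m₀
  rw [sw_tensorCoact _ _ _ _ (by fun_prop) (by fun_prop), LeftRightYD.tensorAct,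
    LinearMap.comp_apply]
  conv_lhs => rw [← sw_tmul_eq_self (Δ h)]
  simp only [lin_sw, sw_apply, TensorProduct.map₂_apply_tmul, TensorProduct.map_tmul, hX _ m,
    hY _ n, sw_tmul_right, tmul_sw, form_mul_right, sw_smul, ← TensorProduct.smul_tmul',
    TensorProduct.tmul_smul, smul_sw,
    mul_smul, sw_comm _ (Δ h)]
  exact sw_congr fun _ _ => sw_comm _ _ _

variable (R) in
theorem isInduced_unitObj : IsInduced R (LeftRightYD.unitObj k H) := by
  intro h c
  change ε h • c = sw (c ⊗ₜ[k] (1 : H)) fun m₀ m₁ => σ h m₁ • m₀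
  rw [sw_tmul (by fun_prop) (by fun_prop), R.one_right]

variable (R)

/-- The coaction `x ↦ x₂ ⊗ S⁻¹(x₁) S⁻²(x₃)`. -/
def bcoact : H →ₗ[k] H ⊗[k] H := (𝑇 ∘ₗ 𝑇).lTensor H ∘ₗ Ad

theorem sw_bcoact (x : H) {f : H → H → Z} (h₁ : ∀ b, IsLinearMap k fun a => f a b)
    (h₂ : ∀ a, IsLinearMap k fun b => f a b) :
    sw (R.bcoact x) f = sw (Ad x) fun a h => f a (𝑇 (𝑇 h)) := by
  simp (disch := fun_prop) only [bcoact, LinearMap.comp_apply, lTensor_eq_sw, sw_sw, sw_tmul]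

theorem bcoact_eq (x : H) : R.bcoact x = sw (Ad x) fun a h => a ⊗ₜ[k] 𝑇 (𝑇 h) := by
  simp only [bcoact, LinearMap.comp_apply, lTensor_eq_sw]

/-- The Yetter–Drinfeld module underlying the braided group of `H`. -/
def braidedModule : LeftRightYD k H H :=
  R.yetterDrinfeld R.bcoact
    (LinearMap.ext fun x => by
      simp only [LinearMap.comp_apply, LinearEquiv.coe_coe, assoc_rTensor_eq_sw, lTensor_eq_sw_sw]
      simp (disch := fun_prop) only [sw_bcoact, sw_comul_antipodeInv, sw_coadjoint_assoc])
    (LinearMap.ext fun x => by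
      simp only [LinearMap.comp_apply, LinearEquiv.coe_coe, rid_lTensor_eq_sw]
      simp (disch := fun_prop) only [sw_bcoact, counit_antipodeInv, sw_coadjoint_counit]
      rfl)

theorem isInduced_braidedModule : IsInduced R R.braidedModule := fun _ _ => rfl

theorem braidedModule_act (h x : H) :
    R.braidedModule.act h x = sw (Ad x) fun a g => σ h (𝑇 (𝑇 g)) • a := by
  rw [isInduced_braidedModule]
  exact R.sw_bcoact x (by fun_prop) (by fun_prop)

/-- Both arguments of σ carry S⁻², which σ ignores; the braiding is therefore the coadjoint one. -/
theorem braidedModule_braiding (x y : H) :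
    LeftRightYD.braiding R.braidedModule R.braidedModule (x ⊗ₜ[k] y) =
      sw (Ad y) fun y g => y ⊗ₜ[k] θ g x := by
  change (TensorProduct.lift R.braidedModule.act).lTensor H
    (TensorProduct.assoc k H H H (R.bcoact y ⊗ₜ[k] x)) = _
  rw [bcoact_eq, sw_tmul_right, map_sw (g := TensorProduct.assoc k H H H)
    (LinearEquiv.toLinearMap _).isLinear]
  simp only [lin_sw, TensorProduct.assoc_tmul, LinearMap.lTensor_tmul, TensorProduct.lift.tmul,
    braidedModule_act, form_antipodeInv_antipodeInv, coadjointAct_apply]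

theorem braidedModule_middleBraiding (p q r s : H) :
    R.braidedModule.middleBraiding ((p ⊗ₜ[k] q) ⊗ₜ[k] (r ⊗ₜ[k] s)) =
      sw (Ad r) fun r f => (p ⊗ₜ[k] r) ⊗ₜ[k] (θ f q ⊗ₜ[k] s) := by
  simp only [LeftRightYD.middleBraiding, LinearMap.comp_apply, LinearEquiv.coe_coe,
    TensorProduct.assoc_tmul, LinearMap.lTensor_tmul, TensorProduct.assoc_symm_tmul,
    LinearMap.rTensor_tmul, braidedModule_braiding, sw_tmul_right]
  rw [map_sw (g := TensorProduct.assoc k H H H) (LinearEquiv.toLinearMap _).isLinear, tmul_sw,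
    map_sw (g := (TensorProduct.assoc k H H (H ⊗[k] H)).symm) (LinearEquiv.toLinearMap _).isLinear]
  simp only [TensorProduct.assoc_tmul, TensorProduct.assoc_symm_tmul]

end CQTStructure

end YetterDrinfeld

/-! ### Assembling the braided Hopf algebra -/

section Braided

variable {k H Z : Type*} [Field k] [Ring H] [HopfAlgebra k H] [AddCommGroup Z] [Module k Z]

local notation "Δ" => Coalgebra.comul (R := k)
local notation "ε" => Coalgebra.counit (R := k)
local notation "𝑆" => HopfAlgebra.antipode k
local notation "Ad" => coadjoint k

namespace CQTStructure

variable (R : CQTStructure k H)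

local notation "σ" => CQTStructure.form R
local notation "τ" => CQTStructure.inv R
local notation "𝑇" => CQTStructure.antipodeInv R
local notation "μ" => CQTStructure.bmul R
local notation "θ" => CQTStructure.coadjointAct R
local notation "δ" => CQTStructure.bcomul R
local notation "υ" => CQTStructure.bantipode R

theorem bcomul_one : δ 1 = (1 : H) ⊗ₜ[k] (1 : H) := by
  rw [bcomul_apply, sw_comul_one (by fun_prop) (by fun_prop),
    sw_coadjoint_one (by fun_prop) (by fun_prop), coadjointAct_one]

theorem lift_bmul_isHom :
    (R.braidedModule.tensor R.braidedModule).IsHom R.braidedModule (TensorProduct.lift μ) := by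
  refine (R.isInduced_braidedModule.tensor R.isInduced_braidedModule).isHom
    R.isInduced_braidedModule (TensorProduct.ext' fun x y => ?_)
  change (TensorProduct.lift μ).rTensor H (LeftRightYD.tensorCoact _ _ (x ⊗ₜ y)) =
    R.bcoact (μ x y)
  rw [rTensor_eq_sw, sw_tensorCoact _ _ _ _ (by fun_prop) (by fun_prop), bcoact_eq,
    sw_coadjoint_bmul _ _ _ (by fun_prop) (by fun_prop)]
  change (sw (R.bcoact x) fun x₀ x₁ => sw (R.bcoact y) fun y₀ y₁ => μ x₀ y₀ ⊗ₜ[k] (y₁ * x₁)) = _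
  simp (disch := fun_prop) only [sw_bcoact, antipodeInv_mul]

theorem linearMap_isHom :
    (LeftRightYD.unitObj k H).IsHom R.braidedModule (Algebra.linearMap k H) := by
  refine R.isInduced_unitObj.isHom R.isInduced_braidedModule (LinearMap.ext_ring ?_)
  change (Algebra.linearMap k H).rTensor H (1 ⊗ₜ 1) = R.bcoact (Algebra.linearMap k H 1)
  rw [bcoact_eq, LinearMap.rTensor_tmul, Algebra.linearMap_apply, map_one,
    sw_coadjoint_one (by fun_prop) (by fun_prop), antipodeInv_one, antipodeInv_one]

theorem bcomul_isHom :
    R.braidedModule.IsHom (R.braidedModule.tensor R.braidedModule) δ := by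
  refine R.isInduced_braidedModule.isHom
    (R.isInduced_braidedModule.tensor R.isInduced_braidedModule) (LinearMap.ext fun x => ?_)
  change (δ).rTensor H (R.bcoact x) =
    LeftRightYD.tensorCoact R.braidedModule R.braidedModule (δ x)
  have tensorCoact (p q : H) : LeftRightYD.tensorCoact R.braidedModule R.braidedModule (p ⊗ₜ q) =
      sw (Ad p) fun p a => sw (Ad q) fun q b => (p ⊗ₜ[k] q) ⊗ₜ[k] 𝑇 (𝑇 (b * a)) := by
    rw [← sw_tmul_eq_self (LeftRightYD.tensorCoact _ _ _),
      sw_tensorCoact _ _ _ _ (by fun_prop) (by fun_prop)]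
    change (sw (R.bcoact p) fun p a => sw (R.bcoact q) fun q b =>
      (p ⊗ₜ[k] q) ⊗ₜ[k] (b * a)) = _
    simp (disch := fun_prop) only [sw_bcoact, antipodeInv_mul]
  conv_rhs => rw [← sw_tmul_eq_self (δ x)]
  rw [lin_sw]
  simp only [tensorCoact]
  rw [← R.sw_coadjoint_bcomul x (f := fun p q h => (p ⊗ₜ[k] q) ⊗ₜ[k] 𝑇 (𝑇 h)) (by fun_prop)
    (by fun_prop) (by fun_prop), rTensor_eq_sw, sw_bcoact _ _ (by fun_prop) (by fun_prop)]
  simp only [← sw_tmul_right, sw_tmul_eq_self]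

theorem counit_isHom :
    R.braidedModule.IsHom (LeftRightYD.unitObj k H) Coalgebra.counit := by
  refine R.isInduced_braidedModule.isHom R.isInduced_unitObj (LinearMap.ext fun x => ?_)
  change (Coalgebra.counit (R := k)).rTensor H (R.bcoact x) = ε x ⊗ₜ[k] (1 : H)
  rw [rTensor_eq_sw, sw_bcoact _ _ (by fun_prop) (by fun_prop)]
  have (a h : H) : ε a ⊗ₜ[k] 𝑇 (𝑇 h) = ε a • ((1 : k) ⊗ₜ[k] 𝑇 (𝑇 h)) := by
    rw [TensorProduct.smul_tmul', smul_eq_mul, mul_one]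
  simp only [this]
  rw [sw_counit_coadjoint x (f := fun h => (1 : k) ⊗ₜ[k] 𝑇 (𝑇 h)) (by fun_prop),
    antipodeInv_one, antipodeInv_one, TensorProduct.smul_tmul', smul_eq_mul, mul_one]

theorem bantipode_isHom : R.braidedModule.IsHom R.braidedModule υ := by
  refine R.isInduced_braidedModule.isHom R.isInduced_braidedModule (LinearMap.ext fun x => ?_)
  change (υ).rTensor H (R.bcoact x) = R.bcoact (υ x)
  rw [rTensor_eq_sw, sw_bcoact _ _ (by fun_prop) (by fun_prop), bcoact_eq,
    sw_coadjoint_bantipode _ _ (by fun_prop) (by fun_prop)]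

/-- The braided group of a coquasitriangular Hopf algebra. -/
def braidedGroup : BraidedHopfAlgebra R.braidedModule where
  mul := TensorProduct.lift μ
  unit := Algebra.linearMap k H
  comul := δ
  counit := Coalgebra.counit
  antipode := υ
  mul_isHom := R.lift_bmul_isHom
  unit_isHom := R.linearMap_isHom
  comul_isHom := R.bcomul_isHom
  counit_isHom := R.counit_isHom
  antipode_isHom := R.bantipode_isHom
  mul_assoc := by
    ext x y z
    exact R.bmul_assoc x y z
  unit_mul := by
    ext x
    change μ (algebraMap k H 1) x = (1 : k) • x
    rw [map_one, one_bmul, one_smul]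
  mul_unit := by
    ext x
    change μ x (algebraMap k H 1) = (1 : k) • x
    rw [map_one, bmul_one, one_smul]
  comul_coassoc := by
    ext x
    simp only [LinearMap.comp_apply, LinearEquiv.coe_coe, assoc_rTensor_eq_sw, lTensor_eq_sw_sw]
    exact R.bcomul_coassoc x (by fun_prop) (by fun_prop) (by fun_prop)
  counit_comul := by
    ext x
    simp only [LinearMap.comp_apply, LinearEquiv.coe_coe, lid_rTensor_eq_sw]
    exact R.counit_bcomul x (f := fun z => z) IsLinearMap.fun_id
  comul_counit := by
    ext x
    simp only [LinearMap.comp_apply, LinearEquiv.coe_coe, rid_lTensor_eq_sw]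
    exact R.bcomul_counit x (f := fun z => z) IsLinearMap.fun_id
  comul_mul := by
    refine TensorProduct.ext' fun x y => ?_
    simp only [LinearMap.comp_apply, TensorProduct.lift.tmul, TensorProduct.map_tmul]
    conv_rhs => rw [← sw_tmul_eq_self (δ x), ← sw_tmul_eq_self (δ y)]
    simp only [sw_tmul_right, tmul_sw, lin_sw, braidedModule_middleBraiding, TensorProduct.map_tmul,
      TensorProduct.lift.tmul]
    rw [sw_comm]
    exact R.bcomul_bmul x y
  comul_unit := by
    simp only [Algebra.linearMap_apply, map_one, bcomul_one]
  counit_mul := by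
    refine TensorProduct.ext' fun x y => ?_
    exact R.counit_bmul x y
  counit_unit := by
    simp only [Algebra.linearMap_apply, map_one, Bialgebra.counit_one]
  antipode_left := by
    ext x
    simp (disch := fun_prop) only [LinearMap.comp_apply, rTensor_eq_sw, lift_eq_sw, sw_sw, sw_tmul,
      bantipode_left, Algebra.linearMap_apply, Algebra.algebraMap_eq_smul_one]
  antipode_right := by
    ext x
    simp (disch := fun_prop) only [LinearMap.comp_apply, lTensor_eq_sw, lift_eq_sw, sw_sw, sw_tmul,
      bantipode_right, Algebra.linearMap_apply, Algebra.algebraMap_eq_smul_one]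

end CQTStructure

end Braided

/-! ### Matching the explicit formulas -/

section Formulas

variable {k H Z : Type*} [Field k] [Ring H] [HopfAlgebra k H] [AddCommGroup Z] [Module k Z]

local notation "Δ" => Coalgebra.comul (R := k)
local notation "ε" => Coalgebra.counit (R := k)
local notation "𝑆" => HopfAlgebra.antipode k
local notation "Ad" => coadjoint k

/-- Passes from an arbitrary representing family to the chosen one; multilinearity makes the value
independent of the choice. -/
theorem IsSweedler₃.sum_eq_sw {x : H} {n : ℕ} {x₁ x₂ x₃ : Fin n → H}
    (hx : IsSweedler₃ k x x₁ x₂ x₃) {f : H → H → H → Z}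
    (h₁ : ∀ b c, IsLinearMap k fun a => f a b c) (h₂ : ∀ a c, IsLinearMap k fun b => f a b c)
    (h₃ : ∀ a b, IsLinearMap k fun c => f a b c) :
    ∑ i, f (x₁ i) (x₂ i) (x₃ i) = sw (Δ x) fun a x => sw (Δ x) fun b c => f a b c := by
  have := congrArg (fun t => sw t fun a t => sw t fun b c => f a b c) hx
  simp (disch := fun_prop) only [sw_sum, sw_tmul, comulIter₃, LinearMap.comp_apply, lTensor_eq_sw,
    sw_sw] at this
  exact this.symm

theorem IsSweedler₄.sum_eq_sw {x : H} {n : ℕ} {x₁ x₂ x₃ x₄ : Fin n → H}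
    (hx : IsSweedler₄ k x x₁ x₂ x₃ x₄) {f : H → H → H → H → Z}
    (h₁ : ∀ b c d, IsLinearMap k fun a => f a b c d)
    (h₂ : ∀ a c d, IsLinearMap k fun b => f a b c d)
    (h₃ : ∀ a b d, IsLinearMap k fun c => f a b c d)
    (h₄ : ∀ a b c, IsLinearMap k fun d => f a b c d) :
    ∑ i, f (x₁ i) (x₂ i) (x₃ i) (x₄ i) =
      sw (Δ x) fun a x => sw (Δ x) fun b x => sw (Δ x) fun c d => f a b c d := by
  have := congrArg (fun t => sw t fun a t => sw t fun b t => sw t fun c d => f a b c d) hx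
  simp (disch := fun_prop) only [sw_sum, sw_tmul, comulIter₄, comulIter₃, LinearMap.comp_apply,
    lTensor_eq_sw, sw_sw] at this
  exact this.symm

theorem IsSweedler₆.sum_eq_sw {x : H} {n : ℕ} {x₁ x₂ x₃ x₄ x₅ x₆ : Fin n → H}
    (hx : IsSweedler₆ k x x₁ x₂ x₃ x₄ x₅ x₆) {f : H → H → H → H → H → H → Z}
    (h₁ : ∀ b c d e g, IsLinearMap k fun a => f a b c d e g)
    (h₂ : ∀ a c d e g, IsLinearMap k fun b => f a b c d e g)
    (h₃ : ∀ a b d e g, IsLinearMap k fun c => f a b c d e g)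
    (h₄ : ∀ a b c e g, IsLinearMap k fun d => f a b c d e g)
    (h₅ : ∀ a b c d g, IsLinearMap k fun e => f a b c d e g)
    (h₆ : ∀ a b c d e, IsLinearMap k fun g => f a b c d e g) :
    ∑ i, f (x₁ i) (x₂ i) (x₃ i) (x₄ i) (x₅ i) (x₆ i) =
      sw (Δ x) fun a x => sw (Δ x) fun b x => sw (Δ x) fun c x => sw (Δ x) fun d x =>
        sw (Δ x) fun e g => f a b c d e g := by
  have := congrArg (fun t => sw t fun a t => sw t fun b t => sw t fun c t => sw t fun d t =>
    sw t fun e g => f a b c d e g) hx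
  simp (disch := fun_prop) only [sw_sum, sw_tmul, comulIter₆, comulIter₅, comulIter₄, comulIter₃,
    LinearMap.comp_apply, lTensor_eq_sw, sw_sw] at this
  exact this.symm

namespace CQTStructure

variable (R : CQTStructure k H)

local notation "σ" => CQTStructure.form R
local notation "τ" => CQTStructure.inv R
local notation "𝑇" => CQTStructure.antipodeInv R
local notation "δ" => CQTStructure.bcomul R

theorem inv₂₁_apply (a b : H) : R.inv₂₁ a b = τ b a := rfl

theorem form_antipodeInv_mul (a b h : H) : σ h (𝑇 a * 𝑇 (𝑇 b)) = τ h (𝑇 b * a) := by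
  rw [← form_antipodeInv, antipodeInv_mul]

theorem inv_antipodeInv_mul (a b c d : H) :
    τ (𝑇 a * b) (𝑆 c * d) = σ (𝑆 b * a) (𝑆 c * d) := by
  rw [← form_antipode_left, HopfAlgebra.antipode_mul_antidistrib, antipode_antipodeInv]

theorem form_antipodeInv_mul_antipodeInv_mul (a b c d : H) :
    σ (𝑇 a * b) (𝑇 c * d) = σ (𝑆 b * a) (𝑆 d * c) := by
  rw [← form_antipode_antipode]
  simp only [HopfAlgebra.antipode_mul_antidistrib, antipode_antipodeInv]

theorem bcomul_eq (x : H) :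
    δ x = sw (Δ x) fun x₁ x => sw (Δ x) fun x₂ x => sw (Δ x) fun x₃ x => sw (Δ x) fun x₄ x =>
      sw (Δ x) fun x₅ x₆ => σ (𝑆 x₁ * x₃) (𝑆 x₄ * x₆) • (x₂ ⊗ₜ[k] x₅) := by
  rw [← sw_tmul_eq_self (δ x), sw_bcomul' _ _ (by fun_prop) (by fun_prop)]
  simp (disch := fun_prop) only [sw_coadjoint, sw_comul_assoc]

end CQTStructure

end Formulas

theorem mainTheorem7 {k H : Type*} [Field k] [Ring H] [HopfAlgebra k H]
    (R : CQTStructure k H) :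
    ∃ T : H →ₗ[k] H,
      -- the antipode `S` of `H` is bijective, with inverse `T = S⁻¹`
      T ∘ₗ HopfAlgebra.antipode k = LinearMap.id ∧
      HopfAlgebra.antipode k ∘ₗ T = LinearMap.id ∧
      ∃ X : LeftRightYD k H H,
        (∀ (x : H) {n : ℕ} (x₁ x₂ x₃ : Fin n → H), IsSweedler₃ k x x₁ x₂ x₃ →
          X.coact x = ∑ i, x₂ i ⊗ₜ[k] (T (x₁ i) * T (T (x₃ i)))) ∧
        (∀ (h x : H) {n : ℕ} (x₁ x₂ x₃ : Fin n → H), IsSweedler₃ k x x₁ x₂ x₃ →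
          X.act h x = ∑ i, R.form h (T (x₁ i) * T (T (x₃ i))) • x₂ i ∧
          X.act h x = ∑ i, R.inv₂₁ (T (x₃ i) * x₁ i) h • x₂ i) ∧
        ∃ B : BraidedHopfAlgebra X,
          B.unit = Algebra.linearMap k H ∧
          B.counit = Coalgebra.counit ∧
          (∀ (x y : H) {n m : ℕ} (x₁ x₂ x₃ : Fin n → H) (y₁ y₂ : Fin m → H),
            IsSweedler₃ k x x₁ x₂ x₃ → IsSweedler₂ k y y₁ y₂ →
            B.mul (x ⊗ₜ[k] y) = ∑ i, ∑ j,
              R.form (HopfAlgebra.antipode k (x₁ i) * x₃ i) (T (y₂ j)) • (x₂ i * y₁ j) ∧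
            B.mul (x ⊗ₜ[k] y) = ∑ i, ∑ j,
              R.inv₂₁ (y₂ j) (HopfAlgebra.antipode k (x₁ i) * x₃ i) • (x₂ i * y₁ j)) ∧
          (∀ (x : H) {n : ℕ} (x₁ x₂ x₃ x₄ x₅ x₆ : Fin n → H),
            IsSweedler₆ k x x₁ x₂ x₃ x₄ x₅ x₆ →
            B.comul x = ∑ i,
              R.form (T (x₃ i) * x₁ i) (T (x₆ i) * x₄ i) • (x₂ i ⊗ₜ[k] x₅ i) ∧
            B.comul x = ∑ i,
              R.inv₂₁ (HopfAlgebra.antipode k (x₄ i) * x₆ i) (T (x₃ i) * x₁ i) •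
                (x₂ i ⊗ₜ[k] x₅ i)) ∧
          (∀ (x : H) {n : ℕ} (x₁ x₂ x₃ x₄ : Fin n → H), IsSweedler₄ k x x₁ x₂ x₃ x₄ →
            B.antipode x = ∑ i,
              R.form (x₁ i * HopfAlgebra.antipode k (x₃ i)) (T (x₄ i)) •
                HopfAlgebra.antipode k (x₂ i) ∧
            B.antipode x = ∑ i,
              R.inv₂₁ (x₄ i) (x₁ i * HopfAlgebra.antipode k (x₃ i)) •
                HopfAlgebra.antipode k (x₂ i)) := by
  simp only [CQTStructure.inv₂₁_apply]
  refine ⟨R.antipodeInv, LinearMap.ext R.antipodeInv_antipode,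
    LinearMap.ext R.antipode_antipodeInv, R.braidedModule, ?_, ?_, R.braidedGroup, rfl, rfl,
    ?_, ?_, ?_⟩
  · intro x n x₁ x₂ x₃ hx
    change R.bcoact x = _
    rw [hx.sum_eq_sw (f := fun a b c => b ⊗ₜ[k] (R.antipodeInv a * R.antipodeInv (R.antipodeInv c)))
      (by fun_prop) (by fun_prop) (by fun_prop), R.bcoact_eq, sw_coadjoint _ (by fun_prop)
      (by fun_prop)]
    simp only [R.antipodeInv_mul, R.antipodeInv_antipode]
  · intro h x n x₁ x₂ x₃ hx
    simp only [R.form_antipodeInv_mul, and_self]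
    rw [hx.sum_eq_sw (f := fun a b c => R.inv h (R.antipodeInv c * a) • b)
      (by fun_prop) (by fun_prop) (by fun_prop), R.braidedModule_act, sw_coadjoint _ (by fun_prop)
      (by fun_prop)]
    simp only [R.antipodeInv_mul, R.antipodeInv_antipode, R.form_antipodeInv_mul]
  · intro x y n m x₁ x₂ x₃ y₁ y₂ hx hy
    simp only [R.form_antipodeInv, and_self]
    change R.bmul x y = _
    have (i : Fin n) := hy.sum_eq_sw (f := fun y₁ y₂ =>
      R.inv (HopfAlgebra.antipode k (x₁ i) * x₃ i) y₂ • (x₂ i * y₁)) (by fun_prop) (by fun_prop)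
    simp only [this]
    rw [hx.sum_eq_sw (f := fun a b c => sw (Coalgebra.comul (R := k) y) fun y₁ y₂ =>
      R.inv (HopfAlgebra.antipode k a * c) y₂ • (b * y₁)) (by fun_prop) (by fun_prop)
      (by fun_prop), R.bmul_apply, sw_coadjoint _ (by fun_prop) (by fun_prop)]
    simp only [R.regAct_apply, mul_sw, mul_smul_comm]
  · intro x n x₁ x₂ x₃ x₄ x₅ x₆ hx
    -- Both stated weights equal σ(S(x₁)x₃, S(x₄)x₆), the form on the two coadjoint legs, by
    -- invariance of σ under S ⊗ S and by σ(S(h), g) = τ(h, g).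
    simp only [R.form_antipodeInv_mul_antipodeInv_mul, R.inv_antipodeInv_mul, and_self]
    rw [hx.sum_eq_sw (f := fun a b c d e g =>
      R.form (HopfAlgebra.antipode k a * c) (HopfAlgebra.antipode k d * g) • (b ⊗ₜ[k] e))
      (by fun_prop) (by fun_prop) (by fun_prop) (by fun_prop) (by fun_prop) (by fun_prop)]
    exact R.bcomul_eq x
  · intro x n x₁ x₂ x₃ x₄ hx
    simp only [R.form_antipodeInv, and_self]
    rw [hx.sum_eq_sw (f := fun a b c d => R.inv (a * HopfAlgebra.antipode k c) d •
      HopfAlgebra.antipode k b) (by fun_prop) (by fun_prop) (by fun_prop) (by fun_prop)]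
    exact R.bantipode_apply x

end
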